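/- A \emph{polyomino} is a finite nonempty edge-connected set of unit cells of the square lattice, considered up to translation. A \emph{parallelogram polyomino} is a polyomino that is horizontally and vertically convex (the cells in each row and in each column are consecutive) and contains the bottom-left and the top-right cell of its minimal bounding rectangle. Its \emph{area} is its number of cells and its \emph{half-perimeter} is the sum of the width and the height of its minimal bounding rectangle. The group $\mathfrak{D}_2$ consisting of the identity, the rotation by $180^\circ$ and the two reflections in the diagonal axes acts on parallelogram polyominoes (up to translation); a parallelogram polyomino is \emph{asymmetric} if it is not fixed by any non-identity element of $\mathfrak{D}_2$. Let $p_n^{(q)}$ (resp. $p_n^{(t)}$) be the number of parallelogram polyominoes of area (resp. half-perimeter) $n$, and let $\overline{p}_n^{(q)}$ (resp. $\overline{p}_n^{(t)}$) be the number of asymmetric parallelogram polyominoes of area (resp. half-perimeter) $n$. Then, as $n\to\infty$, $$\overline{p}_n^{(q)} \sim p_n^{(q)} \qquad\text{and}\qquad \overline{p}_n^{(t)} \sim p_n^{(t)}.$$ -/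

import Mathlib

open scoped Pointwise Asymptotics

namespace Polyomino

/-- A cell of the square lattice: `(i, j)` stands for the unit square `[i, i+1] × [j, j+1]`. -/
abbrev Cell : Type := ℤ × ℤ

/-- Two cells are adjacent when they share an edge. -/
def cellGraph : SimpleGraph Cell where
  Adj a b := |a.1 - b.1| + |a.2 - b.2| = 1
  symm := ⟨fun a b h => by rwa [abs_sub_comm b.1, abs_sub_comm b.2]⟩
  loopless := ⟨fun a h => by simp at h⟩

/-- A polyomino (before passing to translation classes): a finite, nonempty, edge-connected set of
cells. (`SimpleGraph.Connected` includes nonemptiness.) -/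
def IsPolyomino (P : Finset Cell) : Prop :=
  (cellGraph.induce (P : Set Cell)).Connected

/-- Horizontal and vertical convexity: the cells in each row and in each column are consecutive. -/
def IsHVConvex (P : Finset Cell) : Prop :=
  (∀ j : ℤ, {i : ℤ | (i, j) ∈ P}.OrdConnected) ∧ (∀ i : ℤ, {j : ℤ | (i, j) ∈ P}.OrdConnected)

/-- A parallelogram polyomino: a convex polyomino that contains the bottom-left and the top-right
cell of its minimal bounding rectangle. The bottom-left cell of that rectangle has the smallest
abscissa and the smallest ordinate occurring in `P`, so it lies in `P` exactly when `P` has a least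
element for the componentwise order on `ℤ × ℤ`; dually for the top-right cell. -/
def IsParallelogram (P : Finset Cell) : Prop :=
  IsPolyomino P ∧ IsHVConvex P ∧
    (∃ a, IsLeast (P : Set Cell) a) ∧ (∃ b, IsGreatest (P : Set Cell) b)

/-- The area: the number of cells. -/
def area (P : Finset Cell) : ℕ := P.card

/-- The width: the number of columns met by `P`. -/
def width (P : Finset Cell) : ℕ := (P.image Prod.fst).card

/-- The height: the number of rows met by `P`. -/
def height (P : Finset Cell) : ℕ := (P.image Prod.snd).card

/-- The half-perimeter: the sum of the width and the height. -/
def halfPerimeter (P : Finset Cell) : ℕ := width P + height P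

/-- The rotation by a half turn (on cells, up to translation). -/
def halfTurn : Equiv.Perm Cell := Equiv.neg Cell

/-- The reflection in the bisector of the first quadrant. -/
def diagReflection : Equiv.Perm Cell := Equiv.prodComm ℤ ℤ

/-- The reflection in the other diagonal axis (on cells, up to translation). -/
def antidiagReflection : Equiv.Perm Cell := halfTurn * diagReflection

/-- The group `𝔇₂` of symmetries of the square that acts on parallelogram polyominoes: the identity,
the half turn and the two diagonal reflections. -/
def D2 : Subgroup (Equiv.Perm Cell) := Subgroup.closure {halfTurn, diagReflection}

theorem mem_D2_iff (g : Equiv.Perm Cell) :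
    g ∈ D2 ↔ g = 1 ∨ g = halfTurn ∨ g = diagReflection ∨ g = antidiagReflection := by
  have hr : halfTurn * halfTurn = 1 := by ext x <;> simp [halfTurn]
  have hd : diagReflection * diagReflection = 1 := by ext x <;> simp [diagReflection]
  have hc : diagReflection * halfTurn = halfTurn * diagReflection := by
    ext x <;> simp [diagReflection, halfTurn]
  have hri : halfTurn⁻¹ = halfTurn := inv_eq_of_mul_eq_one_left hr
  have hdi : diagReflection⁻¹ = diagReflection := inv_eq_of_mul_eq_one_left hd
  constructor
  · intro h
    have hr' : ∀ a, halfTurn * (halfTurn * a) = a := fun a => by rw [← mul_assoc, hr, one_mul]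
    have hc' : ∀ a, diagReflection * (halfTurn * a) = halfTurn * (diagReflection * a) := fun a => by
      rw [← mul_assoc, hc, mul_assoc]
    induction h using Subgroup.closure_induction with
    | mem x hx =>
      rcases hx with rfl | hx
      · simp
      · rw [Set.mem_singleton_iff.1 hx]; simp
    | one => simp
    | mul x y _ _ ihx ihy =>
      rcases ihx with rfl | rfl | rfl | rfl <;> rcases ihy with rfl | rfl | rfl | rfl <;>
        simp [antidiagReflection, mul_assoc, hr, hd, hc, hr', hc']
    | inv x _ ih =>
      rcases ih with rfl | rfl | rfl | rfl <;>
        simp [antidiagReflection, hri, hdi, hc]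
  · have h1 : halfTurn ∈ D2 := Subgroup.subset_closure (by simp)
    have h2 : diagReflection ∈ D2 := Subgroup.subset_closure (by simp)
    rintro (rfl | rfl | rfl | rfl)
    exacts [D2.one_mem, h1, h2, D2.mul_mem h1 h2]

/-- `P` is `g`-symmetric: the image of `P` under `g` is a translate of `P`, that is, the
translation class of `P` is fixed by `g`. -/
def IsSymmetricUnder (g : Equiv.Perm Cell) (P : Finset Cell) : Prop :=
  ∃ v : Cell, P.map g.toEmbedding = v +ᵥ P

/-- `P` is asymmetric: it is not `g`-symmetric for any `g ∈ 𝔇₂` except the identity. -/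
def IsAsymmetric (P : Finset Cell) : Prop :=
  ∀ g ∈ D2, g ≠ 1 → ¬ IsSymmetricUnder g P

/-- The number of translation classes of the members of a collection of finite sets of cells. -/
noncomputable def numClasses (S : Set (Finset Cell)) : ℕ :=
  ((Quotient.mk (AddAction.orbitRel Cell (Finset Cell))) '' S).ncard

/-- The number of parallelogram polyominoes (up to translation) of area `n`. -/
noncomputable def countArea (n : ℕ) : ℕ :=
  numClasses {P | IsParallelogram P ∧ area P = n}

/-- The number of parallelogram polyominoes (up to translation) of half-perimeter `n`. -/
noncomputable def countHalfPerimeter (n : ℕ) : ℕ :=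
  numClasses {P | IsParallelogram P ∧ halfPerimeter P = n}

/-- The number of asymmetric parallelogram polyominoes (up to translation) of area `n`. -/
noncomputable def asymCountArea (n : ℕ) : ℕ :=
  numClasses {P | IsParallelogram P ∧ IsAsymmetric P ∧ area P = n}

/-- The number of asymmetric parallelogram polyominoes (up to translation) of half-perimeter
`n`. -/
noncomputable def asymCountHalfPerimeter (n : ℕ) : ℕ :=
  numClasses {P | IsParallelogram P ∧ IsAsymmetric P ∧ halfPerimeter P = n}

end Polyomino

/-! Symmetric polyominoes are exponentially rare: a symmetric one is determined by about half of its
data, while the total count has a strictly larger growth rate. Each translation class has a unique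
representative with bottom-left cell at the origin (`numClasses_eq_ncard`), so counting takes place
among `IsNormalized` sets.

The key structure is the slicing by antidiagonals `x + y = d` (`IsNormalized.exists_profile`). Every
slice is an interval whose two end points move by `0` or `1` from one slice to the next, so a
polyomino is a pair of 0/1 step sequences. The half turn and the antidiagonal reflection reverse the
order of the slices, hence the lower half determines the rest. The diagonal reflection preserves
each slice and exchanges its ends, hence one boundary determines the other.

By area, the lower half is spelled as a word over three letters with one letter per cell, which
gives at most `n ^ 3 * 3 ^ (n / 2)` polyominoes for each reversal. Under the diagonal reflection
every slice of odd index has at least two cells, so there are at most about `2n/3` steps and `O(n *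
2 ^ (2n/3))` polyominoes. Both growth rates, `√3` and `2 ^ (2/3)`, are below `7/4`, whereas
attaching a cell to the left of or below the corner shows that the total at least doubles with each
unit of area.

By half-perimeter, each symmetry leaves only `O(n * 2 ^ n)` polyominoes. Doubling would not beat
this, so a third extension, which raises the half-perimeter by two, is added. The recurrence `a (n +
2) ≥ 2 * a (n + 1) + a n` has growth rate `1 + √2 > 12/5 > 2`. -/

namespace Polyomino

/-! ### Normalized polyominoes: convexity and connectedness. -/

section

variable {P : Finset Cell}

/-- `P` is a parallelogram polyomino whose bottom-left cell is the origin and whose top-right cell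
is `b`. -/
structure IsNormalized (P : Finset Cell) (b : Cell) : Prop where
  connected : IsPolyomino P
  convex : IsHVConvex P
  isLeast : IsLeast (P : Set Cell) 0
  isGreatest : IsGreatest (P : Set Cell) b

theorem cellGraph_adj_iff {a b c d : ℤ} : cellGraph.Adj (a, b) (c, d) ↔
    (c = a + 1 ∧ d = b) ∨ (c = a - 1 ∧ d = b) ∨ (c = a ∧ d = b + 1) ∨ (c = a ∧ d = b - 1) := by
  simp only [cellGraph]
  rcases abs_cases (a - c) with h | h <;> rcases abs_cases (b - d) with h' | h' <;> omega

/-- A predicate that is preserved by adjacency inside a polyomino holds everywhere on it as soon as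
it holds somewhere on it. -/
theorem IsPolyomino.forall_of_adj (hP : IsPolyomino P) (S : ℤ → ℤ → Prop)
    (hS : ∀ a b c d, (a, b) ∈ P → (c, d) ∈ P → cellGraph.Adj (a, b) (c, d) → S a b → S c d)
    {a b c d : ℤ} (ha : (a, b) ∈ P) (hab : S a b) (hc : (c, d) ∈ P) : S c d := by
  have h := hP.preconnected ⟨(a, b), ha⟩ ⟨(c, d), hc⟩
  rw [SimpleGraph.reachable_iff_reflTransGen] at h
  have key : ∀ z : (P : Set Cell), Relation.ReflTransGen (cellGraph.induce (P : Set Cell)).Adj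
      ⟨(a, b), ha⟩ z → S z.1.1 z.1.2 := by
    intro z hz
    induction hz with
    | refl => exact hab
    | tail _ h2 ih => exact hS _ _ _ _ (Subtype.prop _) (Subtype.prop _) h2 ih
  exact key _ h

theorem IsHVConvex.row (h : IsHVConvex P) {x y z j : ℤ} (hx : (x, j) ∈ P) (hz : (z, j) ∈ P)
    (hxy : x ≤ y) (hyz : y ≤ z) : (y, j) ∈ P :=
  (h.1 j).out hx hz ⟨hxy, hyz⟩

theorem IsHVConvex.col (h : IsHVConvex P) {x y z i : ℤ} (hx : (i, x) ∈ P) (hz : (i, z) ∈ P)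
    (hxy : x ≤ y) (hyz : y ≤ z) : (i, y) ∈ P :=
  (h.2 i).out hx hz ⟨hxy, hyz⟩

namespace IsNormalized

variable {p q : ℤ}

theorem nonneg (h : IsNormalized P (p, q)) {x y : ℤ} (hx : (x, y) ∈ P) : 0 ≤ x ∧ 0 ≤ y :=
  h.isLeast.2 hx

theorem le (h : IsNormalized P (p, q)) {x y : ℤ} (hx : (x, y) ∈ P) : x ≤ p ∧ y ≤ q :=
  h.isGreatest.2 hx

theorem zero_mem (h : IsNormalized P (p, q)) : ((0 : ℤ), (0 : ℤ)) ∈ P := h.isLeast.1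

theorem top_mem (h : IsNormalized P (p, q)) : (p, q) ∈ P := h.isGreatest.1

/-- The rectangle spanned by a north-west and a south-east cell is contained in the polyomino. -/
theorem rect_mem (h : IsNormalized P (p, q)) {x y x' y' u v : ℤ} (h1 : (x, y) ∈ P)
    (h2 : (x', y') ∈ P) (hxu : x ≤ u) (hux : u ≤ x') (hyv : y' ≤ v) (hvy : v ≤ y) :
    (u, v) ∈ P := by
  by_contra hz
  -- By convexity a missing cell `(u, v)` has an empty horizontal ray and an empty vertical ray.
  -- Together they bound a quadrant that no path in `P` can enter or leave. In each of the four
  -- cases it separates two known cells: a corner from `(x, y)`, or `(x, y)` from `(x', y')`.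
  have hrow : (∀ s, s ≤ u → (s, v) ∉ P) ∨ (∀ s, u ≤ s → (s, v) ∉ P) := by
    by_contra! hc
    obtain ⟨⟨s, hs, hs'⟩, t, ht, ht'⟩ := hc
    exact hz (h.convex.row hs' ht' hs ht)
  have hcol : (∀ s, s ≤ v → (u, s) ∉ P) ∨ (∀ s, v ≤ s → (u, s) ∉ P) := by
    by_contra! hc
    obtain ⟨⟨s, hs, hs'⟩, t, ht, ht'⟩ := hc
    exact hz (h.convex.col hs' ht' hs ht)
  have hb1 := h.le h1
  have hb2 := h.le h2
  have ha1 := h.nonneg h1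
  have ha2 := h.nonneg h2
  have key : ∀ S : ℤ → ℤ → Prop, ∀ a b, (a, b) ∈ P → S a b →
      (∀ a b c d, (a, b) ∈ P → (c, d) ∈ P → cellGraph.Adj (a, b) (c, d) → S a b → S c d) →
      ∀ c d, (c, d) ∈ P → S c d :=
    fun S a b hab hS hadj c d hcd => h.connected.forall_of_adj S hadj hab hS hcd
  have ne1 : ∀ {a b c d : ℤ}, (a, b) ∈ P → (c, d) ∉ P → ¬ (a = c ∧ b = d) := by
    rintro a b c d hab hcd ⟨rfl, rfl⟩; exact hcd hab
  rcases hrow with hr | hr <;> rcases hcol with hc | hc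
  · have := key (fun a b => ¬ (a ≤ u ∧ b ≤ v)) x y h1
      (fun hh => by
        obtain rfl : y = v := by omega
        exact hr x hh.1 h1) (by
      intro a b c d hab hcd hadj hS hh
      have e1 : c ≠ u := by rintro rfl; exact hc d hh.2 hcd
      have e2 : d ≠ v := by rintro rfl; exact hr c hh.1 hcd
      rw [cellGraph_adj_iff] at hadj
      omega) 0 0 h.zero_mem
    omega
  · have := key (fun a b => (a < u ∧ v < b)) x y h1
      (by
        have e1 : x ≠ u := by rintro rfl; exact hc y hvy h1
        have e2 : y ≠ v := by rintro rfl; exact hr x hxu h1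
        omega) (by
      intro a b c d hab hcd hadj hS
      rw [cellGraph_adj_iff] at hadj
      by_contra hh
      have e1 : c = u ∨ d = v := by omega
      rcases e1 with rfl | rfl
      · exact hc d (by omega) hcd
      · exact hr c (by omega) hcd) x' y' h2
    omega
  · have := key (fun a b => (u < a ∧ b < v)) x' y' h2
      (by
        have e1 : x' ≠ u := by rintro rfl; exact hc y' hyv h2
        have e2 : y' ≠ v := by rintro rfl; exact hr x' hux h2
        omega) (by
      intro a b c d hab hcd hadj hS
      rw [cellGraph_adj_iff] at hadj
      by_contra hh
      have e1 : c = u ∨ d = v := by omega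
      rcases e1 with rfl | rfl
      · exact hc d (by omega) hcd
      · exact hr c (by omega) hcd) x y h1
    omega
  · have := key (fun a b => ¬ (u ≤ a ∧ v ≤ b)) x y h1
      (fun hh => by
        obtain rfl : x = u := by omega
        exact hc y hh.2 h1) (by
      intro a b c d hab hcd hadj hS hh
      have e1 : c ≠ u := by rintro rfl; exact hc d hh.2 hcd
      have e2 : d ≠ v := by rintro rfl; exact hr c hh.1 hcd
      rw [cellGraph_adj_iff] at hadj
      omega) p q h.top_mem
    omega

/-- Otherwise convexity empties the whole row to the right of `(x, y)` and the whole column above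
it. The open quadrant to the north-east is then cut off from `(x, y)`, although it contains the
top-right cell. -/
theorem succ_mem (h : IsNormalized P (p, q)) {x y : ℤ} (hx : (x, y) ∈ P) (hlt : x + y < p + q) :
    (x + 1, y) ∈ P ∨ (x, y + 1) ∈ P := by
  by_contra! hcon
  have hr : ∀ s, x < s → (s, y) ∉ P := fun s hs hs' =>
    hcon.1 (h.convex.row hx hs' (by omega) (by omega))
  have hc : ∀ s, y < s → (x, s) ∉ P := fun s hs hs' =>
    hcon.2 (h.convex.col hx hs' (by omega) (by omega))
  have hb := h.le hx
  have e1 : p ≠ x := by rintro rfl; exact hc q (by omega) h.top_mem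
  have e2 : q ≠ y := by rintro rfl; exact hr p (by omega) h.top_mem
  have := h.connected.forall_of_adj (fun a b => x < a ∧ y < b) (by
    intro a b c d hab hcd hadj hS
    rw [cellGraph_adj_iff] at hadj
    by_contra hh
    have e1 : c = x ∨ d = y := by omega
    rcases e1 with rfl | rfl
    · exact hc d (by omega) hcd
    · exact hr c (by omega) hcd) h.top_mem (by omega) hx
  omega

theorem pred_mem (h : IsNormalized P (p, q)) {x y : ℤ} (hx : (x, y) ∈ P) (hlt : 0 < x + y) :
    (x - 1, y) ∈ P ∨ (x, y - 1) ∈ P := by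
  by_contra! hcon
  have hr : ∀ s, s < x → (s, y) ∉ P := fun s hs hs' =>
    hcon.1 (h.convex.row hs' hx (by omega) (by omega))
  have hc : ∀ s, s < y → (x, s) ∉ P := fun s hs hs' =>
    hcon.2 (h.convex.col hs' hx (by omega) (by omega))
  have hb := h.nonneg hx
  have e1 : 0 ≠ x := by rintro rfl; exact hc 0 (by omega) h.zero_mem
  have e2 : 0 ≠ y := by rintro rfl; exact hr 0 (by omega) h.zero_mem
  have := h.connected.forall_of_adj (fun a b => a < x ∧ b < y) (by
    intro a b c d hab hcd hadj hS
    rw [cellGraph_adj_iff] at hadj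
    by_contra hh
    have e1 : c = x ∨ d = y := by omega
    rcases e1 with rfl | rfl
    · exact hc d (by omega) hcd
    · exact hr c (by omega) hcd) h.zero_mem (by omega) hx
  omega

theorem top_nonneg (h : IsNormalized P (p, q)) : 0 ≤ p ∧ 0 ≤ q := h.nonneg h.top_mem

theorem width_eq (h : IsNormalized P (p, q)) : (width P : ℤ) = p + 1 := by
  have : P.image Prod.fst = Finset.Icc 0 p := by
    ext u
    simp only [Finset.mem_image, Prod.exists, exists_and_right, exists_eq_right, Finset.mem_Icc]
    constructor
    · rintro ⟨y, hy⟩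
      exact ⟨(h.nonneg hy).1, (h.le hy).1⟩
    · rintro ⟨h0, hp⟩
      by_contra! hcon
      have := h.connected.forall_of_adj (fun a _ => a < u) (by
        intro a b c d hab hcd hadj hS
        have : c ≠ u := by rintro rfl; exact hcon d hcd
        rw [cellGraph_adj_iff] at hadj
        omega) h.zero_mem (by
          have : 0 ≠ u := by rintro rfl; exact hcon 0 h.zero_mem
          omega) h.top_mem
      omega
  rw [width, this, Int.card_Icc]
  have := h.top_nonneg
  omega

theorem height_eq (h : IsNormalized P (p, q)) : (height P : ℤ) = q + 1 := by
  have : P.image Prod.snd = Finset.Icc 0 q := by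
    ext u
    simp only [Finset.mem_image, Prod.exists, exists_eq_right, Finset.mem_Icc]
    constructor
    · rintro ⟨y, hy⟩
      exact ⟨(h.nonneg hy).2, (h.le hy).2⟩
    · rintro ⟨h0, hp⟩
      by_contra! hcon
      have := h.connected.forall_of_adj (fun _ a => a < u) (by
        intro a b c d hab hcd hadj hS
        have : d ≠ u := by rintro rfl; exact hcon c hcd
        rw [cellGraph_adj_iff] at hadj
        omega) h.zero_mem (by
          have : 0 ≠ u := by rintro rfl; exact hcon 0 h.zero_mem
          omega) h.top_mem
      omega
  rw [height, this, Int.card_Icc]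
  have := h.top_nonneg
  omega

theorem halfPerimeter_eq (h : IsNormalized P (p, q)) :
    (halfPerimeter P : ℤ) = p + q + 2 := by
  rw [halfPerimeter, Nat.cast_add, h.width_eq, h.height_eq]
  ring

end IsNormalized

end

/-! ### Antidiagonal slices. -/

section

variable {P P' : Finset Cell} {p q p' q' : ℤ} {M : ℕ} {lo hi lo' hi' : ℕ → ℤ}

/-- The slices of `P` by the antidiagonals `x + y = d` are the intervals `lo d ≤ x ≤ hi d` for
`d ≤ M`, and their end points advance by `0` or `1` from each slice to the next. -/
structure IsProfile (P : Finset Cell) (M : ℕ) (lo hi : ℕ → ℤ) : Prop where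
  mem_iff : ∀ x y, (x, y) ∈ P ↔ ∃ d : ℕ, d ≤ M ∧ x + y = d ∧ lo d ≤ x ∧ x ≤ hi d
  le : ∀ d ≤ M, lo d ≤ hi d
  lo_zero : lo 0 = 0
  hi_zero : hi 0 = 0
  lo_step : ∀ d < M, lo (d + 1) = lo d ∨ lo (d + 1) = lo d + 1
  hi_step : ∀ d < M, hi (d + 1) = hi d ∨ hi (d + 1) = hi d + 1

theorem IsNormalized.exists_slice (h : IsNormalized P (p, q)) (hM : p + q = M) :
    ∀ d ≤ M, ∃ x : ℤ, (x, (d : ℤ) - x) ∈ P := by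
  intro d
  induction d with
  | zero => exact fun _ => ⟨0, by simpa using h.zero_mem⟩
  | succ d ih =>
    intro hd
    obtain ⟨x, hx⟩ := ih (by omega)
    rcases h.succ_mem hx (by omega) with h1 | h1
    · refine ⟨x + 1, ?_⟩
      convert h1 using 2; push_cast; ring
    · refine ⟨x, ?_⟩
      convert h1 using 2; push_cast; ring

/-- Two cells of one antidiagonal are the north-west and south-east corners of a rectangle inside
`P`, so slices are intervals. The steps are controlled by `succ_mem` and `pred_mem` applied to the
end points. -/
theorem IsNormalized.exists_profile (h : IsNormalized P (p, q)) (hM : p + q = M) :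
    ∃ lo hi, IsProfile P M lo hi := by
  have key : ∀ d : ℕ, ∃ l r : ℤ, d ≤ M → l ≤ r ∧ ∀ x, (x, (d : ℤ) - x) ∈ P ↔ l ≤ x ∧ x ≤ r := by
    intro d
    by_cases hd : d ≤ M
    swap
    · exact ⟨0, 0, fun h => absurd h hd⟩
    obtain ⟨x₀, hx₀⟩ := h.exists_slice hM d hd
    set A : Finset ℤ := (Finset.Icc 0 p).filter fun x => (x, (d : ℤ) - x) ∈ P with hA
    have hmem : ∀ x, x ∈ A ↔ (x, (d : ℤ) - x) ∈ P := by
      intro x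
      simp only [hA, Finset.mem_filter, Finset.mem_Icc, and_iff_right_iff_imp]
      exact fun hx => ⟨(h.nonneg hx).1, (h.le hx).1⟩
    have hne : A.Nonempty := ⟨x₀, (hmem _).2 hx₀⟩
    refine ⟨A.min' hne, A.max' hne, fun _ => ⟨A.min'_le _ (A.max'_mem hne), fun x => ?_⟩⟩
    constructor
    · intro hx
      exact ⟨A.min'_le _ ((hmem x).2 hx), A.le_max' _ ((hmem x).2 hx)⟩
    · rintro ⟨h1, h2⟩
      exact h.rect_mem ((hmem _).1 (A.min'_mem hne)) ((hmem _).1 (A.max'_mem hne)) h1 h2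
        (by omega) (by omega)
  choose lo hi hlh using key
  have hle : ∀ d ≤ M, lo d ≤ hi d := fun d hd => (hlh d hd).1
  have hm : ∀ d ≤ M, ∀ x, (x, (d : ℤ) - x) ∈ P ↔ lo d ≤ x ∧ x ≤ hi d := fun d hd => (hlh d hd).2
  have hm' : ∀ d ≤ M, ∀ x y, x + y = (d : ℤ) → (x, y) ∈ P → lo d ≤ x ∧ x ≤ hi d := by
    intro d hd x y hxy hx
    obtain rfl : y = d - x := by omega
    exact (hm d hd x).1 hx
  have hlo : ∀ d ≤ M, (lo d, (d : ℤ) - lo d) ∈ P := fun d hd => (hm d hd _).2 ⟨le_rfl, hle d hd⟩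
  have hhi : ∀ d ≤ M, (hi d, (d : ℤ) - hi d) ∈ P := fun d hd => (hm d hd _).2 ⟨hle d hd, le_rfl⟩
  have hup : ∀ d < M, ∀ x, (x, (d : ℤ) - x) ∈ P →
      (lo (d + 1) ≤ x + 1 ∧ x + 1 ≤ hi (d + 1)) ∨ (lo (d + 1) ≤ x ∧ x ≤ hi (d + 1)) := by
    intro d hd x hx
    rcases h.succ_mem hx (by omega) with h1 | h1
    · exact .inl (hm' (d + 1) hd _ _ (by push_cast; ring) h1)
    · exact .inr (hm' (d + 1) hd _ _ (by push_cast; ring) h1)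
  have hdn : ∀ d < M, ∀ x, (x, ((d + 1 : ℕ) : ℤ) - x) ∈ P →
      (lo d ≤ x - 1 ∧ x - 1 ≤ hi d) ∨ (lo d ≤ x ∧ x ≤ hi d) := by
    intro d hd x hx
    rcases h.pred_mem hx (by omega) with h1 | h1
    · exact .inl (hm' d hd.le _ _ (by push_cast; ring) h1)
    · exact .inr (hm' d hd.le _ _ (by push_cast; ring) h1)
  refine ⟨lo, hi, ⟨?_, hle, ?_, ?_, ?_, ?_⟩⟩
  · intro x y
    constructor
    · intro hx
      have h1 := h.nonneg hx
      have h2 := h.le hx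
      obtain ⟨d, hd⟩ := Int.eq_ofNat_of_zero_le (show 0 ≤ x + y by omega)
      exact ⟨d, by omega, hd, hm' d (by omega) x y hd hx⟩
    · rintro ⟨d, hd, hxy, hx⟩
      obtain rfl : y = d - x := by omega
      exact (hm d hd x).2 hx
  · have h1 := hlo 0 (Nat.zero_le _)
    have := h.nonneg h1
    push_cast at this; omega
  · have h1 := hhi 0 (Nat.zero_le _)
    have := h.nonneg h1
    push_cast at this; omega
  -- A successor of the cell at `lo d` gives `lo (d + 1) ≤ lo d + 1`; a predecessor of the cell at
  -- `lo (d + 1)` gives `lo d ≤ lo (d + 1)`.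
  · intro d hd
    have h1 := hup d hd _ (hlo d hd.le)
    have h2 := hdn d hd _ (hlo (d + 1) hd)
    omega
  · intro d hd
    have h1 := hup d hd _ (hhi d hd.le)
    have h2 := hdn d hd _ (hhi (d + 1) hd)
    omega

namespace IsProfile

theorem lo_mem (h : IsProfile P M lo hi) {d : ℕ} (hd : d ≤ M) : (lo d, (d : ℤ) - lo d) ∈ P :=
  (h.mem_iff _ _).2 ⟨d, hd, by ring, le_rfl, h.le d hd⟩

theorem hi_mem (h : IsProfile P M lo hi) {d : ℕ} (hd : d ≤ M) : (hi d, (d : ℤ) - hi d) ∈ P :=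
  (h.mem_iff _ _).2 ⟨d, hd, by ring, h.le d hd, le_rfl⟩

theorem mem_slice_iff (h : IsProfile P M lo hi) {d : ℕ} (hd : d ≤ M) {x y : ℤ} (hxy : x + y = d) :
    (x, y) ∈ P ↔ lo d ≤ x ∧ x ≤ hi d := by
  rw [h.mem_iff]
  constructor
  · rintro ⟨e, -, he, hx⟩
    obtain rfl : e = d := by omega
    exact hx
  · exact fun hx => ⟨d, hd, hxy, hx⟩

theorem card_slice (h : IsProfile P M lo hi) {d : ℕ} (hd : d ≤ M) :
    (P.filter fun c => c.1 + c.2 = (d : ℤ)).card = (hi d - lo d).toNat + 1 := by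
  have : (P.filter fun c => c.1 + c.2 = (d : ℤ)) =
      (Finset.Icc (lo d) (hi d)).image fun x => (x, (d : ℤ) - x) := by
    ext ⟨x, y⟩
    simp only [Finset.mem_filter, Finset.mem_image, Finset.mem_Icc, Prod.mk.injEq]
    constructor
    · rintro ⟨h1, h2⟩
      exact ⟨x, (h.mem_slice_iff hd h2).1 h1, rfl, by omega⟩
    · rintro ⟨a, ha, rfl, rfl⟩
      exact ⟨(h.mem_slice_iff hd (by ring)).2 ha, by ring⟩
  rw [this, Finset.card_image_of_injective _ (fun a b hab => (Prod.mk.inj hab).1), Int.card_Icc]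
  have := h.le d hd
  omega

theorem area_eq (h : IsProfile P M lo hi) :
    area P = ∑ d ∈ Finset.range (M + 1), ((hi d - lo d).toNat + 1) := by
  rw [area, Finset.card_eq_sum_card_fiberwise (f := fun c : Cell => (c.1 + c.2).toNat)
    (t := Finset.range (M + 1))]
  · refine Finset.sum_congr rfl fun d hd => ?_
    have hd' : d ≤ M := by simpa [Nat.lt_succ_iff] using hd
    rw [← h.card_slice hd']
    congr 1
    refine Finset.filter_congr ?_
    rintro ⟨x, y⟩ hxy
    obtain ⟨e, -, he, -⟩ := (h.mem_iff x y).1 hxy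
    simp only
    omega
  · rintro ⟨x, y⟩ hxy
    obtain ⟨e, he, he', -⟩ := (h.mem_iff x y).1 hxy
    simp only [Finset.coe_range, Set.mem_Iio]
    omega

theorem lt_area (h : IsProfile P M lo hi) : M < area P := by
  rw [h.area_eq]
  have : ∑ d ∈ Finset.range (M + 1), 1 ≤ ∑ d ∈ Finset.range (M + 1), ((hi d - lo d).toNat + 1) :=
    Finset.sum_le_sum fun _ _ => by omega
  simpa using this

end IsProfile

/-! ### Symmetries in coordinates and reversals of the slices. -/

theorem IsSymmetricUnder.exists_mem_iff {g : Equiv.Perm Cell} (h : IsSymmetricUnder g P) :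
    ∃ v : Cell, (∀ c, c ∈ P ↔ g c - v ∈ P) ∧ ∀ c ∈ P, ∃ d ∈ P, g d = v + c := by
  obtain ⟨v, hv⟩ := h
  refine ⟨v, fun c => ?_, fun c hc => ?_⟩
  · have h1 : g c ∈ P.map g.toEmbedding ↔ c ∈ P := by simp
    rw [← h1, hv, ← Finset.mem_coe, Finset.coe_vadd_finset, Set.mem_vadd_set_iff_neg_vadd_mem,
      vadd_eq_add, neg_add_eq_sub, Finset.mem_coe]
  · have h1 : v + c ∈ v +ᵥ P := Finset.vadd_mem_vadd_finset hc
    rw [← hv, Finset.mem_map] at h1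
    exact h1

/-- The translation vector is forced to be `(-p, -q)`: the image of the top-right cell bounds it on
one side, and the preimage of the translated origin on the other. -/
theorem IsNormalized.halfTurn_mem_iff (h : IsNormalized P (p, q))
    (hs : IsSymmetricUnder halfTurn P) (x y : ℤ) : (x, y) ∈ P ↔ (p - x, q - y) ∈ P := by
  obtain ⟨⟨v, w⟩, h1, h2⟩ := hs.exists_mem_iff
  obtain ⟨⟨a, b⟩, h3, h4⟩ := h2 _ h.zero_mem
  have h5 := h.nonneg ((h1 _).1 h.top_mem)
  have h6 := h.le h3
  simp only [halfTurn, Equiv.neg_apply, Prod.neg_mk, Prod.mk_add_mk, Prod.mk.injEq] at h4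
  simp only [halfTurn, Equiv.neg_apply, Prod.neg_mk] at h5
  rw [h1]
  simp only [halfTurn, Equiv.neg_apply, Prod.neg_mk, Prod.mk_sub_mk]
  rw [show -x - v = p - x by omega, show -y - w = q - y by omega]

theorem IsNormalized.diagReflection_mem_iff (h : IsNormalized P (p, q))
    (hs : IsSymmetricUnder diagReflection P) (x y : ℤ) : (x, y) ∈ P ↔ (y, x) ∈ P := by
  obtain ⟨⟨v, w⟩, h1, h2⟩ := hs.exists_mem_iff
  obtain ⟨⟨a, b⟩, h3, h4⟩ := h2 _ h.zero_mem
  have h5 := h.nonneg ((h1 _).1 h.zero_mem)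
  have h6 := h.nonneg h3
  simp only [diagReflection, Equiv.prodComm_apply, Prod.swap, Prod.mk_add_mk, Prod.mk.injEq] at h4
  simp only [diagReflection, Equiv.prodComm_apply, Prod.swap] at h5
  rw [h1]
  simp only [diagReflection, Equiv.prodComm_apply, Prod.swap, Prod.mk_sub_mk]
  rw [show y - v = y by omega, show x - w = x by omega]

theorem IsNormalized.antidiagReflection_mem_iff (h : IsNormalized P (p, q))
    (hs : IsSymmetricUnder antidiagReflection P) (x y : ℤ) :
    (x, y) ∈ P ↔ (q - y, p - x) ∈ P := by
  obtain ⟨⟨v, w⟩, h1, h2⟩ := hs.exists_mem_iff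
  obtain ⟨⟨a, b⟩, h3, h4⟩ := h2 _ h.zero_mem
  have h5 := h.nonneg ((h1 _).1 h.top_mem)
  have h6 := h.le h3
  simp only [antidiagReflection, halfTurn, diagReflection, Equiv.Perm.mul_apply, Equiv.neg_apply,
    Equiv.prodComm_apply, Prod.swap, Prod.neg_mk, Prod.mk_add_mk, Prod.mk.injEq] at h4
  simp only [antidiagReflection, halfTurn, diagReflection, Equiv.Perm.mul_apply, Equiv.neg_apply,
    Equiv.prodComm_apply, Prod.swap, Prod.neg_mk] at h5
  rw [h1]
  simp only [antidiagReflection, halfTurn, diagReflection, Equiv.Perm.mul_apply, Equiv.neg_apply,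
    Equiv.prodComm_apply, Prod.swap, Prod.neg_mk, Prod.mk_sub_mk]
  rw [show -y - v = q - y by omega, show -x - w = p - x by omega]

/-- `σ` reverses the order of the antidiagonals `x + y = d`, for `0 ≤ d ≤ p + q`. The half turn and
the antidiagonal reflection of a polyomino with corners `0` and `(p, q)` have this property. -/
def IsReversal (p q : ℤ) (σ : Cell → Cell) : Prop :=
  Function.Bijective σ ∧ ∀ c, (σ c).1 + (σ c).2 = p + q - (c.1 + c.2)

theorem isReversal_halfTurn (p q : ℤ) : IsReversal p q fun c => (p - c.1, q - c.2) :=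
  ⟨Function.Involutive.bijective fun c => by ext <;> simp, fun c => by simp only; ring⟩

/-- For `p ≠ q` this map is not an involution, but bijectivity is all that is needed, so `p = q`
need not be derived. -/
theorem isReversal_antidiagReflection (p q : ℤ) : IsReversal p q fun c => (q - c.2, p - c.1) :=
  ⟨Function.bijective_iff_has_inverse.2
    ⟨fun c => (p - c.2, q - c.1), fun c => by ext <;> simp, fun c => by ext <;> simp⟩,
    fun c => by simp only; ring⟩

/-- Two polyominoes with a common reversal that agree on the lower half are equal. -/
theorem IsReversal.eq_of_lower_half {σ : Cell → Cell} (hσ : IsReversal p q σ)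
    (h : ∀ c, c ∈ P ↔ σ c ∈ P) (h' : ∀ c, c ∈ P' ↔ σ c ∈ P')
    (hag : ∀ x y : ℤ, 2 * (x + y) ≤ p + q → ((x, y) ∈ P ↔ (x, y) ∈ P')) : P = P' := by
  ext c
  by_cases hc : 2 * (c.1 + c.2) ≤ p + q
  · exact hag c.1 c.2 hc
  · rw [h, h']
    exact hag (σ c).1 (σ c).2 (by rw [hσ.2]; omega)

theorem IsProfile.mem_iff_mem_of_agree (h : IsProfile P M lo hi) (h' : IsProfile P' M lo' hi')
    {N : ℤ} (hlo : ∀ d ≤ M, 2 * (d : ℤ) ≤ N → lo d = lo' d)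
    (hhi : ∀ d ≤ M, 2 * (d : ℤ) ≤ N → hi d = hi' d) (x y : ℤ) (hxy : 2 * (x + y) ≤ N) :
    (x, y) ∈ P ↔ (x, y) ∈ P' := by
  rw [h.mem_iff, h'.mem_iff]
  refine exists_congr fun d => and_congr_right fun hd => and_congr_right fun he => ?_
  rw [hlo d hd (by omega), hhi d hd (by omega)]

/-- The sizes of the slices of a polyomino with a reversal form a palindrome. -/
theorem IsReversal.size_symm {σ : Cell → Cell} (hσ : IsReversal p q σ)
    (h : ∀ c, c ∈ P ↔ σ c ∈ P) (hM : p + q = M) (hp : IsProfile P M lo hi) {d : ℕ} (hd : d ≤ M) :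
    (hi (M - d) - lo (M - d)).toNat = (hi d - lo d).toNat := by
  have h1 := hp.card_slice hd
  have h2 := hp.card_slice (Nat.sub_le M d)
  have h3 : (P.filter fun c => c.1 + c.2 = ((M - d : ℕ) : ℤ)).card =
      (P.filter fun c => c.1 + c.2 = (d : ℤ)).card := by
    refine Finset.card_bij (fun c _ => σ c) ?_ (fun a _ b _ hab => hσ.1.1 hab) ?_
    · intro c hc
      rw [Finset.mem_filter] at hc ⊢
      refine ⟨(h c).1 hc.1, ?_⟩
      rw [hσ.2]; omega
    · intro c hc
      rw [Finset.mem_filter] at hc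
      obtain ⟨e, rfl⟩ := hσ.1.2 c
      refine ⟨e, ?_, rfl⟩
      rw [Finset.mem_filter]
      refine ⟨(h e).2 hc.1, ?_⟩
      have := hσ.2 e
      omega
  omega

theorem sum_range_two_mul_of_symm {s : ℕ → ℕ} {D : ℕ}
    (hs : ∀ d ≤ 2 * D + 1, s (2 * D + 1 - d) = s d) :
    ∑ d ∈ Finset.range (2 * D + 1 + 1), s d = 2 * ∑ d ∈ Finset.range (D + 1), s d := by
  rw [show 2 * D + 1 + 1 = (D + 1) + (D + 1) by ring, Finset.sum_range_add, two_mul,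
    ← Finset.sum_range_reflect s (D + 1)]
  congr 1
  refine Finset.sum_congr rfl fun d hd => ?_
  have := Finset.mem_range.1 hd
  rw [← hs _ (by omega)]
  congr 1; omega

theorem sum_range_two_mul_add_one_of_symm {s : ℕ → ℕ} {D : ℕ}
    (hs : ∀ d ≤ 2 * D, s (2 * D - d) = s d) :
    ∑ d ∈ Finset.range (2 * D + 1), s d = 2 * ∑ d ∈ Finset.range D, s d + s D := by
  rw [show 2 * D + 1 = (D + 1) + D by ring, Finset.sum_range_add, Finset.sum_range_succ, two_mul,
    add_right_comm]
  congr 2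
  rw [← Finset.sum_range_reflect s D]
  refine Finset.sum_congr rfl fun d hd => ?_
  have := Finset.mem_range.1 hd
  rw [← hs _ (by omega)]
  congr 1; omega

end

/-! ### Counting symmetric polyominoes. -/

section

variable {P P' : Finset Cell} {p q p' q' : ℤ} {M : ℕ} {lo hi lo' hi' : ℕ → ℤ}

/-- A set whose members are determined by labels from a finite type is no larger than this type. -/
theorem finite_and_ncard_le_of_labels {α T : Type*} [Fintype T] {S : Set α} (R : α → T → Prop)
    (hex : ∀ a ∈ S, ∃ t, R a t) (huniq : ∀ a ∈ S, ∀ b ∈ S, ∀ t, R a t → R b t → a = b) :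
    S.Finite ∧ S.ncard ≤ Fintype.card T := by
  choose f hf using hex
  have hinj : Function.Injective fun a : S => f a.1 a.2 := fun a b hab =>
    Subtype.ext (huniq _ a.2 _ b.2 _ (hf _ a.2) ((show f a.1 a.2 = f b.1 b.2 from hab) ▸ hf _ b.2))
  refine ⟨Finite.of_injective _ hinj, ?_⟩
  rw [← Nat.card_eq_fintype_card]
  exact Nat.card_le_card_of_injective _ hinj

theorem eq_of_same_steps {f g : ℕ → ℤ} {K : ℕ} (h0 : f 0 = g 0)
    (hf : ∀ d < K, f (d + 1) = f d ∨ f (d + 1) = f d + 1)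
    (hg : ∀ d < K, g (d + 1) = g d ∨ g (d + 1) = g d + 1)
    (hfg : ∀ d < K, f (d + 1) = f d ↔ g (d + 1) = g d) : ∀ d ≤ K, f d = g d := by
  intro d
  induction d with
  | zero => exact fun _ => h0
  | succ d ih =>
    intro hd
    have h1 := ih (by omega)
    have h2 := hf d (by omega)
    have h3 := hg d (by omega)
    have h4 := hfg d (by omega)
    omega

theorem IsNormalized.exists_profile' (h : IsNormalized P (p, q)) :
    ∃ (M : ℕ) (lo hi : ℕ → ℤ), p + q = M ∧ IsProfile P M lo hi := by
  have := h.top_nonneg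
  obtain ⟨M, hM⟩ := Int.eq_ofNat_of_zero_le (show 0 ≤ p + q by omega)
  obtain ⟨lo, hi, hp⟩ := h.exists_profile hM
  exact ⟨M, lo, hi, hM, hp⟩

theorem IsNormalized.lt_area (h : IsNormalized P (p, q)) : p + q < area P := by
  obtain ⟨M, lo, hi, hM, hp⟩ := h.exists_profile'
  have := hp.lt_area
  omega

/-- The swap of coordinates acts on slice `d` by `x ↦ d - x`. Hence `hi` determines `lo`, and `hi d
- lo d` has the parity of `d`. -/
theorem IsProfile.lo_add_hi_of_diag (h : IsProfile P M lo hi)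
    (hs : ∀ x y, (x, y) ∈ P ↔ (y, x) ∈ P) {d : ℕ} (hd : d ≤ M) : lo d + hi d = d := by
  have h1 := (h.mem_slice_iff hd (by ring)).1 ((hs _ _).1 (h.lo_mem hd))
  have h2 := (h.mem_slice_iff hd (by ring)).1 ((hs _ _).1 (h.hi_mem hd))
  omega

theorem two_mul_sum_one_add_mod_two (N : ℕ) :
    3 * N ≤ 2 * ∑ d ∈ Finset.range N, (d % 2 + 1) + N % 2 := by
  induction N with
  | zero => simp
  | succ N ih => rw [Finset.sum_range_succ]; omega

/-- By parity a slice of odd index has at least two cells, so slices contain `3/2` cells on average.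
-/
theorem IsProfile.three_mul_le_of_diag (h : IsProfile P M lo hi)
    (hs : ∀ x y, (x, y) ∈ P ↔ (y, x) ∈ P) : 3 * M ≤ 2 * area P := by
  have h1 : ∑ d ∈ Finset.range (M + 1), (d % 2 + 1) ≤ area P := by
    rw [h.area_eq]
    refine Finset.sum_le_sum fun d hd => ?_
    have hd' : d ≤ M := by simpa [Nat.lt_succ_iff] using hd
    have h2 := h.lo_add_hi_of_diag hs hd'
    have h3 := h.le d hd'
    omega
  have := two_mul_sum_one_add_mod_two (M + 1)
  omega

/-- A label consists of the number of steps and the steps of `hi`. The inequality on the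
half-perimeter lets one bound serve both gradings: `K = n` for the half-perimeter and `K = 2 * n /
3` for the area. -/
theorem ncard_diagReflection_le (K : ℕ) :
    {P | (∃ b, IsNormalized P b) ∧ IsSymmetricUnder diagReflection P ∧
      halfPerimeter P ≤ K + 2}.Finite ∧
    {P | (∃ b, IsNormalized P b) ∧ IsSymmetricUnder diagReflection P ∧
      halfPerimeter P ≤ K + 2}.ncard ≤ (K + 1) * 2 ^ K := by
  have := finite_and_ncard_le_of_labels (S := {P | (∃ b, IsNormalized P b) ∧
      IsSymmetricUnder diagReflection P ∧ halfPerimeter P ≤ K + 2})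
    (T := Fin (K + 1) × (Fin K → Bool))
    (fun P t => ∃ lo hi, IsProfile P t.1 lo hi ∧ (∀ x y, (x, y) ∈ P ↔ (y, x) ∈ P) ∧
      ∀ d : Fin K, t.2 d = decide (hi (d + 1) = hi d)) ?_ ?_
  · simpa using this
  · rintro P ⟨⟨⟨p, q⟩, hP⟩, hs, hK⟩
    obtain ⟨M, lo, hi, hM, hp⟩ := hP.exists_profile'
    have := hP.halfPerimeter_eq
    exact ⟨(⟨M, by omega⟩, fun d => decide (hi (d + 1) = hi d)), lo, hi, hp,
      hP.diagReflection_mem_iff hs, fun d => rfl⟩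
  · rintro P - P' - ⟨⟨M, hM⟩, t⟩ ⟨lo, hi, hp, hs, ht⟩ ⟨lo', hi', hp', hs', ht'⟩
    simp only at hp hp' ht ht'
    have hhi : ∀ d ≤ M, hi d = hi' d := by
      refine eq_of_same_steps (by rw [hp.hi_zero, hp'.hi_zero]) hp.hi_step hp'.hi_step ?_
      intro d hd
      have h1 := ht ⟨d, by omega⟩
      rw [ht' ⟨d, by omega⟩] at h1
      simpa using h1.symm
    have hlo : ∀ d ≤ M, lo d = lo' d := by
      intro d hd
      have h1 := hp.lo_add_hi_of_diag hs hd
      have h2 := hp'.lo_add_hi_of_diag hs' hd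
      have h3 := hhi d hd
      omega
    ext ⟨x, y⟩
    exact hp.mem_iff_mem_of_agree hp' (fun d hd _ => hlo d hd) (fun d hd _ => hhi d hd) x y le_rfl

/-- The half turn and the antidiagonal reflection act on a symmetric polyomino by a reversal
that depends only on its top-right cell. -/
theorem exists_isReversal {g : Equiv.Perm Cell} (hg : g = halfTurn ∨ g = antidiagReflection)
    (p q : ℤ) : ∃ σ, IsReversal p q σ ∧
      ∀ P, IsNormalized P (p, q) → IsSymmetricUnder g P → ∀ c, c ∈ P ↔ σ c ∈ P := by
  rcases hg with rfl | rfl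
  · exact ⟨_, isReversal_halfTurn p q, fun P h hs c => h.halfTurn_mem_iff hs c.1 c.2⟩
  · exact ⟨_, isReversal_antidiagReflection p q,
      fun P h hs c => h.antidiagReflection_mem_iff hs c.1 c.2⟩

theorem ncard_reversal_halfPerimeter_le {g : Equiv.Perm Cell}
    (hg : g = halfTurn ∨ g = antidiagReflection) (n : ℕ) :
    {P | (∃ b, IsNormalized P b) ∧ IsSymmetricUnder g P ∧ halfPerimeter P = n}.Finite ∧
    {P | (∃ b, IsNormalized P b) ∧ IsSymmetricUnder g P ∧ halfPerimeter P = n}.ncard ≤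
      n * 2 ^ n := by
  have := finite_and_ncard_le_of_labels (S := {P | (∃ b, IsNormalized P b) ∧
      IsSymmetricUnder g P ∧ halfPerimeter P = n})
    -- The label holds `p` and the lower-half steps of both boundaries. There are `n - 2` steps in
    -- all, so `(n - 1) / 2` of them reach the middle slice; `2 ≤ n` is recorded because that
    -- subtraction is truncated.
    (T := Fin n × (Fin ((n - 1) / 2) → Bool) × (Fin ((n - 1) / 2) → Bool))
    (fun P t => ∃ lo hi, IsNormalized P ((t.1 : ℕ), (n : ℤ) - 2 - (t.1 : ℕ)) ∧
      IsProfile P (n - 2) lo hi ∧ IsSymmetricUnder g P ∧ 2 ≤ n ∧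
      (∀ d : Fin ((n - 1) / 2), t.2.1 d = decide (lo (d + 1) = lo d)) ∧
      ∀ d : Fin ((n - 1) / 2), t.2.2 d = decide (hi (d + 1) = hi d)) ?_ ?_
  · refine ⟨this.1, this.2.trans ?_⟩
    simp only [Fintype.card_prod, Fintype.card_fin, Fintype.card_fun, Fintype.card_bool]
    rw [← pow_add]
    exact Nat.mul_le_mul_left _ (Nat.pow_le_pow_right (by norm_num) (by omega))
  · rintro P ⟨⟨⟨p, q⟩, hP⟩, hs, hK⟩
    have h1 := hP.halfPerimeter_eq
    have h2 := hP.top_nonneg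
    obtain ⟨lo, hi, hp⟩ := hP.exists_profile (M := n - 2) (by omega)
    refine ⟨(⟨p.toNat, by omega⟩, fun d => decide (lo (d + 1) = lo d),
      fun d => decide (hi (d + 1) = hi d)), lo, hi, ?_, hp, hs, by omega, fun d => rfl, fun d => rfl⟩
    convert hP using 2
    · simp only; omega
    · simp only; omega
  · rintro P - P' - ⟨⟨k, hk⟩, t, u⟩ ⟨lo, hi, hP, hp, hs, hn, ht, hu⟩ ⟨lo', hi', hP', hp', hs', -, ht', hu'⟩
    simp only at hP hP' ht ht' hu hu'
    obtain ⟨σ, hσ, hσP⟩ := exists_isReversal hg (k : ℕ) ((n : ℤ) - 2 - (k : ℕ))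
    refine hσ.eq_of_lower_half (hσP P hP hs) (hσP P' hP' hs')
      (hp.mem_iff_mem_of_agree hp' ?_ ?_)
    · intro d hd hd'
      refine eq_of_same_steps (K := (n - 1) / 2) (by rw [hp.lo_zero, hp'.lo_zero])
        (fun d hd => hp.lo_step d (by omega)) (fun d hd => hp'.lo_step d (by omega)) ?_ d (by omega)
      intro d hd
      have h1 := ht ⟨d, by omega⟩
      rw [ht' ⟨d, by omega⟩] at h1
      simpa using h1.symm
    · intro d hd hd'
      refine eq_of_same_steps (K := (n - 1) / 2) (by rw [hp.hi_zero, hp'.hi_zero])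
        (fun d hd => hp.hi_step d (by omega)) (fun d hd => hp'.hi_step d (by omega)) ?_ d (by omega)
      intro d hd
      have h1 := hu ⟨d, by omega⟩
      rw [hu' ⟨d, by omega⟩] at h1
      simpa using h1.symm

/-! ### Encoding the lower half by a word with one letter per cell. -/

/-- The word over three letters in which a pair `(k, b)` is spelled as `k` zeros followed by a
letter that records `b`. -/
def spell : List (ℕ × Bool) → List (Fin 3)
  | [] => []
  | (k, b) :: l => List.replicate k 0 ++ (if b then 1 else 2) :: spell l

theorem length_spell (l : List (ℕ × Bool)) :
    (spell l).length = (l.map fun a => a.1 + 1).sum := by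
  induction l with
  | nil => rfl
  | cons a l ih => obtain ⟨k, b⟩ := a; simp [spell, ih]; ring

/-- Each block ends at its only nonzero letter, so the blocks form a prefix code. -/
theorem spell_injective : Function.Injective spell := by
  have key : ∀ (k k' : ℕ) (x x' : Fin 3) (w w' : List (Fin 3)), x ≠ 0 → x' ≠ 0 →
      List.replicate k 0 ++ x :: w = List.replicate k' 0 ++ x' :: w' → k = k' ∧ x = x' ∧ w = w' := by
    intro k
    induction k with
    | zero =>
      intro k' x x' w w' hx hx' h
      cases k' with
      | zero => simpa using h
      | succ k' => simp [List.replicate_succ] at h; exact absurd h.1 hx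
    | succ k ih =>
      intro k' x x' w w' hx hx' h
      cases k' with
      | zero => simp [List.replicate_succ] at h; exact absurd h.1.symm hx'
      | succ k' =>
        simp only [List.replicate_succ, List.cons_append, List.cons.injEq, true_and] at h
        simpa using ih k' x x' w w' hx hx' h
  intro l
  induction l with
  | nil =>
    rintro (_ | ⟨⟨k, b⟩, l'⟩) h
    · rfl
    · simp [spell] at h
  | cons a l ih =>
    obtain ⟨k, b⟩ := a
    rintro (_ | ⟨⟨k', b'⟩, l'⟩) h
    · simp [spell] at h
    · obtain ⟨rfl, hb, hl⟩ := key k k' _ _ _ _ (by split <;> decide) (by split <;> decide) h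
      rw [ih hl]
      cases b <;> cases b' <;> simp_all

/-- The word that records the sizes of the first `D` slices and the first `D` steps of `lo`. -/
def halfWord (lo hi : ℕ → ℤ) (D : ℕ) : List (Fin 3) :=
  spell ((List.range D).map fun d => ((hi d - lo d).toNat, decide (lo (d + 1) = lo d)))

theorem length_halfWord (lo hi : ℕ → ℤ) (D : ℕ) :
    (halfWord lo hi D).length = ∑ d ∈ Finset.range D, ((hi d - lo d).toNat + 1) := by
  rw [halfWord, length_spell, List.map_map, Finset.sum_range, ← List.sum_ofFn, List.ofFn_eq_map,
    ← List.map_coe_finRange_eq_range, List.map_map]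
  rfl

theorem halfWord_eq_iff {D : ℕ} : halfWord lo hi D = halfWord lo' hi' D ↔
    ∀ d < D, (hi d - lo d).toNat = (hi' d - lo' d).toNat ∧
      (lo (d + 1) = lo d ↔ lo' (d + 1) = lo' d) := by
  rw [halfWord, halfWord, spell_injective.eq_iff, List.map_inj_left]
  simp

/-- The area of a polyomino with a reversal, in terms of its lower half. -/
theorem IsReversal.area_eq {σ : Cell → Cell} (hσ : IsReversal p q σ)
    (h : ∀ c, c ∈ P ↔ σ c ∈ P) (hM : p + q = M) (hp : IsProfile P M lo hi) :
    area P = 2 * ∑ d ∈ Finset.range ((M + 1) / 2), ((hi d - lo d).toNat + 1) +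
      if M % 2 = 0 then (hi (M / 2) - lo (M / 2)).toNat + 1 else 0 := by
  rw [hp.area_eq]
  have hsym : ∀ d ≤ M, (hi (M - d) - lo (M - d)).toNat + 1 = (hi d - lo d).toNat + 1 :=
    fun d hd => by rw [hσ.size_symm h hM hp hd]
  clear hp hM
  rcases Nat.even_or_odd' M with ⟨D, rfl | rfl⟩
  · rw [sum_range_two_mul_add_one_of_symm (s := fun d => (hi d - lo d).toNat + 1) hsym,
      if_pos (by omega), show (2 * D + 1) / 2 = D by omega, show 2 * D / 2 = D by omega]
  · rw [sum_range_two_mul_of_symm (s := fun d => (hi d - lo d).toNat + 1) hsym,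
      if_neg (by omega), show (2 * D + 1 + 1) / 2 = D + 1 by omega, add_zero]

theorem ncard_reversal_area_le {g : Equiv.Perm Cell}
    (hg : g = halfTurn ∨ g = antidiagReflection) (n : ℕ) :
    {P | (∃ b, IsNormalized P b) ∧ IsSymmetricUnder g P ∧ area P = n}.Finite ∧
    {P | (∃ b, IsNormalized P b) ∧ IsSymmetricUnder g P ∧ area P = n}.ncard ≤
      n * n * n * 3 ^ (n / 2) := by
  have := finite_and_ncard_le_of_labels (S := {P | (∃ b, IsNormalized P b) ∧
      IsSymmetricUnder g P ∧ area P = n})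
    -- The label holds `p`, the number of steps, the length of the word and the word padded by `0`
    -- to length `n / 2`. Recording the length keeps the padding apart from genuine zeros.
    (T := (Fin n × Fin n × Fin n) × (Fin (n / 2) → Fin 3))
    (fun P t => ∃ lo hi, IsNormalized P ((t.1.1 : ℕ), ((t.1.2.1 : ℕ) : ℤ) - (t.1.1 : ℕ)) ∧
      IsProfile P t.1.2.1 lo hi ∧ IsSymmetricUnder g P ∧
      (halfWord lo hi ((t.1.2.1 + 1) / 2)).length = t.1.2.2 ∧
      (halfWord lo hi ((t.1.2.1 + 1) / 2)).length ≤ n / 2 ∧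
      ∀ i : Fin (n / 2), t.2 i = (halfWord lo hi ((t.1.2.1 + 1) / 2)).getD i 0) ?_ ?_
  · refine ⟨this.1, this.2.trans (le_of_eq ?_)⟩
    simp only [Fintype.card_prod, Fintype.card_fin, Fintype.card_fun]
    ring
  · rintro P ⟨⟨⟨p, q⟩, hP⟩, hs, hn⟩
    obtain ⟨M, lo, hi, hM, hp⟩ := hP.exists_profile'
    have h1 := hp.lt_area
    have h2 := hP.top_nonneg
    obtain ⟨σ, hσ, hσP⟩ := exists_isReversal hg p q
    have h3 := hσ.area_eq (hσP P hP hs) hM hp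
    rw [← length_halfWord] at h3
    refine ⟨((⟨p.toNat, by omega⟩, ⟨M, by omega⟩, ⟨(halfWord lo hi ((M + 1) / 2)).length, by omega⟩),
      fun i => (halfWord lo hi ((M + 1) / 2)).getD i 0), lo, hi, ?_, hp, hs, rfl, ?_, fun i => rfl⟩
    · convert hP using 2
      · simp only; omega
      · simp only; omega
    · simp only; omega
  · rintro P ⟨-, -, ha⟩ P' ⟨-, -, ha'⟩ ⟨⟨⟨k, hk⟩, ⟨M, hM⟩, ⟨m, hm⟩⟩, t⟩
      ⟨lo, hi, hP, hp, hs, hl, hl', ht⟩ ⟨lo', hi', hP', hp', hs', hm, hm', ht'⟩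
    simp only at hP hP' hp hp' hl hl' hm hm' ht ht'
    obtain ⟨σ, hσ, hσP⟩ := exists_isReversal hg (k : ℕ) ((M : ℤ) - (k : ℕ))
    have hw : halfWord lo hi ((M + 1) / 2) = halfWord lo' hi' ((M + 1) / 2) := by
      refine List.ext_getElem (hl.trans hm.symm) fun i h1 h2 => ?_
      have h3 := ht ⟨i, by omega⟩
      rw [ht' ⟨i, by omega⟩] at h3
      rw [← List.getD_eq_getElem _ 0 h1, ← List.getD_eq_getElem _ 0 h2]
      exact h3.symm
    have hA := hσ.area_eq (hσP P hP hs) (by ring) hp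
    have hA' := hσ.area_eq (hσP P' hP' hs') (by ring) hp'
    rw [← length_halfWord] at hA hA'
    rw [halfWord_eq_iff] at hw
    have hlo : ∀ d ≤ (M + 1) / 2, lo d = lo' d :=
      eq_of_same_steps (by rw [hp.lo_zero, hp'.lo_zero])
        (fun d hd => hp.lo_step d (by omega)) (fun d hd => hp'.lo_step d (by omega))
        fun d hd => (hw d hd).2
    refine hσ.eq_of_lower_half (hσP P hP hs) (hσP P' hP' hs')
      (hp.mem_iff_mem_of_agree hp' (fun d hd hd' => hlo d (by omega)) ?_)
    intro d hd hd'
    have h1 := hlo d (by omega)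
    have h2 := hp.le d hd
    have h3 := hp'.le d hd
    by_cases hdD : d < (M + 1) / 2
    · have h4 := (hw d hdD).1
      omega
    -- The word omits the middle slice, which exists for even `M`; its size is recovered from the
    -- common area.
    · have h5 : d = M / 2 := by omega
      rw [if_pos (by omega), ← h5] at hA hA'
      omega

end

/-! ### Translation classes and their normalized representatives. -/

section

variable {P P' : Finset Cell} {p q : ℤ}

theorem mem_vadd_iff {a b x y : ℤ} : (x, y) ∈ ((a, b) : Cell) +ᵥ P ↔ (x - a, y - b) ∈ P := by
  rw [← Finset.mem_coe, Finset.coe_vadd_finset, Set.mem_vadd_set_iff_neg_vadd_mem,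
    Finset.mem_coe, vadd_eq_add, neg_add_eq_sub, Prod.mk_sub_mk]

theorem IsPolyomino.vadd (hP : IsPolyomino P) (v : Cell) : IsPolyomino (v +ᵥ P) := by
  have hnon := hP.nonempty
  let f : cellGraph.induce (P : Set Cell) →g cellGraph.induce ((v +ᵥ P : Finset Cell) : Set Cell) :=
    { toFun := fun c => ⟨v + c.1, Finset.vadd_mem_vadd_finset c.2⟩
      map_rel' := by
        intro a b hab
        simpa [cellGraph] using hab }
  have hf : Function.Surjective f := by
    rintro ⟨c, hc⟩
    obtain ⟨d, hd, rfl⟩ := Finset.mem_vadd_finset.1 (Finset.mem_coe.1 hc)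
    exact ⟨⟨d, hd⟩, rfl⟩
  have : Nonempty ((v +ᵥ P : Finset Cell) : Set Cell) := hnon.map f
  exact ⟨hP.preconnected.map f hf⟩

theorem IsPolyomino.insert (hP : IsPolyomino P) {c d : Cell} (hd : d ∈ P)
    (hcd : cellGraph.Adj c d) : IsPolyomino (insert c P) := by
  have h1 : (cellGraph.induce {c}).Preconnected := by
    intro a b
    rw [Subsingleton.elim a b]
  have := SimpleGraph.connected_induce_union (G := cellGraph) (s := {c}) (t := (P : Set Cell))
    (v := c) (w := d) h1 hP.preconnected rfl hd hcd
  rw [IsPolyomino, Finset.coe_insert, Set.insert_eq]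
  exact this

theorem IsHVConvex.vadd (hP : IsHVConvex P) (v : Cell) : IsHVConvex (v +ᵥ P) := by
  obtain ⟨a, b⟩ := v
  constructor
  · refine fun j => ⟨fun x hx z hz y hy => ?_⟩
    simp only [Set.mem_ofPred_eq, mem_vadd_iff] at hx hz ⊢
    exact hP.row hx hz (by linarith [hy.1]) (by linarith [hy.2])
  · refine fun j => ⟨fun x hx z hz y hy => ?_⟩
    simp only [Set.mem_ofPred_eq, mem_vadd_iff] at hx hz ⊢
    exact hP.col hx hz (by linarith [hy.1]) (by linarith [hy.2])

theorem isLeast_vadd {a : Cell} (h : IsLeast (P : Set Cell) a) (v : Cell) :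
    IsLeast ((v +ᵥ P : Finset Cell) : Set Cell) (v + a) := by
  refine ⟨Finset.vadd_mem_vadd_finset h.1, fun c hc => ?_⟩
  obtain ⟨d, hd, rfl⟩ := Finset.mem_vadd_finset.1 (Finset.mem_coe.1 hc)
  exact add_le_add_right (h.2 hd) v

theorem isGreatest_vadd {a : Cell} (h : IsGreatest (P : Set Cell) a) (v : Cell) :
    IsGreatest ((v +ᵥ P : Finset Cell) : Set Cell) (v + a) := by
  refine ⟨Finset.vadd_mem_vadd_finset h.1, fun c hc => ?_⟩
  obtain ⟨d, hd, rfl⟩ := Finset.mem_vadd_finset.1 (Finset.mem_coe.1 hc)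
  exact add_le_add_right (h.2 hd) v

theorem IsParallelogram.vadd (hP : IsParallelogram P) (v : Cell) : IsParallelogram (v +ᵥ P) := by
  obtain ⟨h1, h2, ⟨a, ha⟩, b, hb⟩ := hP
  exact ⟨h1.vadd v, h2.vadd v, ⟨_, isLeast_vadd ha v⟩, _, isGreatest_vadd hb v⟩

theorem IsParallelogram.exists_isNormalized_vadd (hP : IsParallelogram P) :
    ∃ (v : Cell) (b : Cell), IsNormalized (v +ᵥ P) b := by
  obtain ⟨h1, h2, ⟨a, ha⟩, b, hb⟩ := hP
  refine ⟨-a, _, h1.vadd _, h2.vadd _, ?_, isGreatest_vadd hb _⟩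
  simpa using isLeast_vadd ha (-a)

theorem IsNormalized.isParallelogram {b : Cell} (h : IsNormalized P b) : IsParallelogram P :=
  ⟨h.connected, h.convex, ⟨_, h.isLeast⟩, _, h.isGreatest⟩

theorem area_vadd (v : Cell) : area (v +ᵥ P) = area P := by
  simp [area]

theorem halfPerimeter_vadd (v : Cell) : halfPerimeter (v +ᵥ P) = halfPerimeter P := by
  have h1 : (v +ᵥ P).image Prod.fst = (P.image Prod.fst).image (v.1 + ·) := by
    simp only [← Finset.image_vadd, Finset.image_image]; rfl
  have h2 : (v +ᵥ P).image Prod.snd = (P.image Prod.snd).image (v.2 + ·) := by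
    simp only [← Finset.image_vadd, Finset.image_image]; rfl
  rw [halfPerimeter, width, height, h1, h2, Finset.card_image_of_injective _ (add_right_injective _),
    Finset.card_image_of_injective _ (add_right_injective _)]
  rfl

theorem mk_vadd (v : Cell) :
    Quotient.mk (AddAction.orbitRel Cell (Finset Cell)) (v +ᵥ P) = Quotient.mk _ P :=
  Quotient.sound ⟨v, rfl⟩

theorem image_mk_isParallelogram {Q : Finset Cell → Prop} (hQ : ∀ (v : Cell) P, Q P → Q (v +ᵥ P)) :
    Quotient.mk (AddAction.orbitRel Cell (Finset Cell)) '' {P | IsParallelogram P ∧ Q P} =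
      Quotient.mk _ '' {P | (∃ b, IsNormalized P b) ∧ Q P} := by
  ext c
  constructor
  · rintro ⟨P, ⟨hP, hq⟩, rfl⟩
    obtain ⟨v, b, hv⟩ := hP.exists_isNormalized_vadd
    exact ⟨v +ᵥ P, ⟨⟨b, hv⟩, hQ v P hq⟩, mk_vadd v⟩
  · rintro ⟨P, ⟨⟨b, hP⟩, hq⟩, rfl⟩
    exact ⟨P, ⟨hP.isParallelogram, hq⟩, rfl⟩

/-- Every translation class of parallelogram polyominoes has exactly one normalized member. -/
theorem numClasses_eq_ncard {Q : Finset Cell → Prop} (hQ : ∀ (v : Cell) P, Q P → Q (v +ᵥ P)) :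
    numClasses {P | IsParallelogram P ∧ Q P} = {P | (∃ b, IsNormalized P b) ∧ Q P}.ncard := by
  rw [numClasses, image_mk_isParallelogram hQ, Set.InjOn.ncard_image]
  rintro P ⟨⟨b, hP⟩, -⟩ P' ⟨⟨b', hP'⟩, -⟩ h
  obtain ⟨v, hv⟩ := Quotient.exact h
  simp only at hv
  have h1 := isLeast_vadd hP'.isLeast v
  rw [hv] at h1
  have h2 := hP.isLeast.unique h1
  rw [add_zero] at h2
  rw [← hv, ← h2, zero_vadd]

theorem numClasses_asymmetric_le {Q : Finset Cell → Prop} (hQ : ∀ (v : Cell) P, Q P → Q (v +ᵥ P))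
    (hfin : {P | (∃ b, IsNormalized P b) ∧ Q P}.Finite) :
    numClasses {P | IsParallelogram P ∧ IsAsymmetric P ∧ Q P} ≤
      numClasses {P | IsParallelogram P ∧ Q P} := by
  refine Set.ncard_le_ncard (Set.image_mono fun P hP => ⟨hP.1, hP.2.2⟩) ?_
  rw [image_mk_isParallelogram hQ]
  exact hfin.image _

/-- A union bound over the three non-identity elements of `D2`. The case split is made on the
normalized representative, so translation invariance of `IsAsymmetric` is not required. -/
theorem numClasses_le_asymmetric_add {Q : Finset Cell → Prop} (hQ : ∀ (v : Cell) P, Q P → Q (v +ᵥ P))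
    (hfin : {P | (∃ b, IsNormalized P b) ∧ Q P}.Finite) :
    numClasses {P | IsParallelogram P ∧ Q P} ≤
      numClasses {P | IsParallelogram P ∧ IsAsymmetric P ∧ Q P} +
      ({P | (∃ b, IsNormalized P b) ∧ IsSymmetricUnder halfTurn P ∧ Q P}.ncard +
       {P | (∃ b, IsNormalized P b) ∧ IsSymmetricUnder antidiagReflection P ∧ Q P}.ncard +
       {P | (∃ b, IsNormalized P b) ∧ IsSymmetricUnder diagReflection P ∧ Q P}.ncard) := by
  set S : Equiv.Perm Cell → Set (Finset Cell) :=
    fun g => {P | (∃ b, IsNormalized P b) ∧ IsSymmetricUnder g P ∧ Q P} with hS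
  have hSfin : ∀ g, (S g).Finite := fun g => hfin.subset fun P hP => ⟨hP.1, hP.2.2⟩
  set mk := Quotient.mk (AddAction.orbitRel Cell (Finset Cell)) with hmk
  have hAfin : (mk '' {P | IsParallelogram P ∧ IsAsymmetric P ∧ Q P}).Finite := by
    refine Set.Finite.subset (s := mk '' {P | IsParallelogram P ∧ Q P}) ?_
      (Set.image_mono fun P hP => ⟨hP.1, hP.2.2⟩)
    rw [image_mk_isParallelogram hQ]
    exact hfin.image _
  have hsub : mk '' {P | IsParallelogram P ∧ Q P} ⊆
      mk '' {P | IsParallelogram P ∧ IsAsymmetric P ∧ Q P} ∪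
        mk '' (S halfTurn ∪ S antidiagReflection ∪ S diagReflection) := by
    rw [image_mk_isParallelogram hQ]
    rintro - ⟨P, ⟨⟨b, hP⟩, hq⟩, rfl⟩
    by_cases ha : IsAsymmetric P
    · exact .inl ⟨P, ⟨hP.isParallelogram, ha, hq⟩, rfl⟩
    · refine .inr ⟨P, ?_, rfl⟩
      simp only [IsAsymmetric, not_forall, not_not] at ha
      obtain ⟨g, hg, hg1, hs⟩ := ha
      rcases (mem_D2_iff g).1 hg with rfl | rfl | rfl | rfl
      · exact absurd rfl hg1
      · exact .inl (.inl ⟨⟨b, hP⟩, hs, hq⟩)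
      · exact .inr ⟨⟨b, hP⟩, hs, hq⟩
      · exact .inl (.inr ⟨⟨b, hP⟩, hs, hq⟩)
  have hUfin := ((hSfin halfTurn).union (hSfin antidiagReflection)).union (hSfin diagReflection)
  refine (Set.ncard_le_ncard hsub (hAfin.union (hUfin.image _))).trans
    ((Set.ncard_union_le _ _).trans (Nat.add_le_add_left ?_ _))
  exact (Set.ncard_image_le hUfin).trans ((Set.ncard_union_le _ _).trans
    (Nat.add_le_add_right (Set.ncard_union_le _ _) _))

theorem finite_isNormalized (n : ℕ) :
    {P | ∃ p q : ℤ, IsNormalized P (p, q) ∧ p + q ≤ n}.Finite := by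
  refine Set.Finite.subset
    (Finset.finite_toSet (Finset.Icc ((0 : ℤ), (0 : ℤ)) ((n : ℤ), (n : ℤ))).powerset) ?_
  rintro P ⟨p, q, hP, hpq⟩
  rw [Finset.mem_coe, Finset.mem_powerset]
  rintro ⟨x, y⟩ hxy
  have h1 := hP.nonneg hxy
  have h2 := hP.le hxy
  simp only [Finset.mem_Icc, Prod.mk_le_mk]
  omega

theorem finite_isNormalized_area (n : ℕ) :
    {P | (∃ b, IsNormalized P b) ∧ area P = n}.Finite := by
  refine (finite_isNormalized n).subset ?_
  rintro P ⟨⟨⟨p, q⟩, hP⟩, rfl⟩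
  exact ⟨p, q, hP, hP.lt_area.le⟩

theorem finite_isNormalized_halfPerimeter (n : ℕ) :
    {P | (∃ b, IsNormalized P b) ∧ halfPerimeter P = n}.Finite := by
  refine (finite_isNormalized n).subset ?_
  rintro P ⟨⟨⟨p, q⟩, hP⟩, rfl⟩
  exact ⟨p, q, hP, by rw [hP.halfPerimeter_eq]; omega⟩

/-! ### Extensions at the bottom-left corner. -/

/-- Attach a cell to the left of the bottom-left cell. -/
def extendLeft (P : Finset Cell) : Finset Cell := insert (0, 0) (((1, 0) : Cell) +ᵥ P)

/-- Attach a cell below the bottom-left cell. -/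
def extendDown (P : Finset Cell) : Finset Cell := insert (0, 0) (((0, 1) : Cell) +ᵥ P)

/-- Attach a cell to the left of the bottom-left cell, another one below it, and the cell that
completes the square. -/
def extendBoth (P : Finset Cell) : Finset Cell :=
  insert (0, 0) (insert (1, 0) (insert (0, 1) (((1, 1) : Cell) +ᵥ P)))

theorem mem_extendLeft {x y : ℤ} :
    (x, y) ∈ extendLeft P ↔ (x = 0 ∧ y = 0) ∨ (x - 1, y) ∈ P := by
  simp [extendLeft, mem_vadd_iff]

theorem mem_extendDown {x y : ℤ} :
    (x, y) ∈ extendDown P ↔ (x = 0 ∧ y = 0) ∨ (x, y - 1) ∈ P := by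
  simp [extendDown, mem_vadd_iff]

theorem mem_extendBoth {x y : ℤ} : (x, y) ∈ extendBoth P ↔
    (x = 0 ∧ y = 0) ∨ (x = 1 ∧ y = 0) ∨ (x = 0 ∧ y = 1) ∨ (x - 1, y - 1) ∈ P := by
  simp [extendBoth, mem_vadd_iff]

theorem isHVConvex_iff : IsHVConvex P ↔
    (∀ x y z j, (x, j) ∈ P → (z, j) ∈ P → x < y → y < z → (y, j) ∈ P) ∧
    (∀ x y z i, (i, x) ∈ P → (i, z) ∈ P → x < y → y < z → (i, y) ∈ P) := by
  constructor
  · exact fun h => ⟨fun x y z j hx hz h1 h2 => h.row hx hz h1.le h2.le,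
      fun x y z j hx hz h1 h2 => h.col hx hz h1.le h2.le⟩
  · rintro ⟨h1, h2⟩
    constructor
    · refine fun j => ⟨fun x hx z hz y hy => ?_⟩
      rcases hy.1.eq_or_lt with rfl | h3
      · exact hx
      rcases hy.2.eq_or_lt with rfl | h4
      · exact hz
      exact h1 x y z j hx hz h3 h4
    · refine fun j => ⟨fun x hx z hz y hy => ?_⟩
      rcases hy.1.eq_or_lt with rfl | h3
      · exact hx
      rcases hy.2.eq_or_lt with rfl | h4
      · exact hz
      exact h2 x y z j hx hz h3 h4

namespace IsNormalized

theorem extendLeft (h : IsNormalized P (p, q)) : IsNormalized (extendLeft P) (p + 1, q) := by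
  have h0 := h.zero_mem
  refine ⟨(h.connected.vadd _).insert (d := (1, 0)) (by simpa [mem_vadd_iff] using h0)
    (by simp [cellGraph_adj_iff]), isHVConvex_iff.2 ⟨?_, ?_⟩, ⟨?_, ?_⟩, ⟨?_, ?_⟩⟩
  · simp only [mem_extendLeft]
    rintro x y z j (⟨rfl, rfl⟩ | hx) (hz | hz) h1 h2
    · omega
    · exact .inr (h.convex.row h0 hz (by omega) (by omega))
    · have := h.nonneg hx; omega
    · exact .inr (h.convex.row hx hz (by omega) (by omega))
  · simp only [mem_extendLeft]
    rintro x y z j (⟨rfl, rfl⟩ | hx) (hz | hz) h1 h2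
    · omega
    · have := h.nonneg hz; omega
    · have := h.nonneg hx; omega
    · exact .inr (h.convex.col hx hz (by omega) (by omega))
  · exact mem_extendLeft.2 (.inl ⟨rfl, rfl⟩)
  · rintro ⟨x, y⟩ hxy
    rcases mem_extendLeft.1 hxy with ⟨rfl, rfl⟩ | hx
    · exact le_rfl
    · have := h.nonneg hx
      exact ⟨by simp only [Prod.fst_zero]; omega, by simp only [Prod.snd_zero]; omega⟩
  · exact mem_extendLeft.2 (.inr (by simpa using h.top_mem))
  · rintro ⟨x, y⟩ hxy
    have := h.top_nonneg
    rcases mem_extendLeft.1 hxy with ⟨rfl, rfl⟩ | hx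
    · exact ⟨by simp only; omega, by simp only; omega⟩
    · have := h.le hx
      exact ⟨by simp only; omega, by simp only; omega⟩

theorem extendDown (h : IsNormalized P (p, q)) : IsNormalized (extendDown P) (p, q + 1) := by
  have h0 := h.zero_mem
  refine ⟨(h.connected.vadd _).insert (d := (0, 1)) (by simpa [mem_vadd_iff] using h0)
    (by simp [cellGraph_adj_iff]), isHVConvex_iff.2 ⟨?_, ?_⟩, ⟨?_, ?_⟩, ⟨?_, ?_⟩⟩
  · simp only [mem_extendDown]
    rintro x y z j (⟨rfl, rfl⟩ | hx) (hz | hz) h1 h2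
    · omega
    · have := h.nonneg hz; omega
    · have := h.nonneg hx; omega
    · exact .inr (h.convex.row hx hz (by omega) (by omega))
  · simp only [mem_extendDown]
    rintro x y z j (⟨rfl, rfl⟩ | hx) (hz | hz) h1 h2
    · omega
    · exact .inr (h.convex.col h0 hz (by omega) (by omega))
    · have := h.nonneg hx; omega
    · exact .inr (h.convex.col hx hz (by omega) (by omega))
  · exact mem_extendDown.2 (.inl ⟨rfl, rfl⟩)
  · rintro ⟨x, y⟩ hxy
    rcases mem_extendDown.1 hxy with ⟨rfl, rfl⟩ | hx
    · exact le_rfl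
    · have := h.nonneg hx
      exact ⟨by simp only [Prod.fst_zero]; omega, by simp only [Prod.snd_zero]; omega⟩
  · exact mem_extendDown.2 (.inr (by simpa using h.top_mem))
  · rintro ⟨x, y⟩ hxy
    have := h.top_nonneg
    rcases mem_extendDown.1 hxy with ⟨rfl, rfl⟩ | hx
    · exact ⟨by simp only; omega, by simp only; omega⟩
    · have := h.le hx
      exact ⟨by simp only; omega, by simp only; omega⟩

theorem extendBoth (h : IsNormalized P (p, q)) : IsNormalized (extendBoth P) (p + 1, q + 1) := by
  have h0 := h.zero_mem
  have h11 : ((1, 1) : Cell) ∈ ((1, 1) : Cell) +ᵥ P := by simpa [mem_vadd_iff] using h0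
  refine ⟨(((h.connected.vadd _).insert (d := (1, 1)) h11
      (by simp [cellGraph_adj_iff])).insert (d := (1, 1)) (Finset.mem_insert_of_mem h11)
      (by simp [cellGraph_adj_iff])).insert (d := (1, 0)) (Finset.mem_insert_self _ _)
      (by simp [cellGraph_adj_iff]), isHVConvex_iff.2 ⟨?_, ?_⟩, ⟨?_, ?_⟩, ⟨?_, ?_⟩⟩
  · simp only [mem_extendBoth]
    intro x y z j hx hz h1 h2
    -- All abscissas are nonnegative, so `x < y < z` forces `z ≥ 2`, which excludes the three added
    -- cells.
    have hz' : (z - 1, j - 1) ∈ P := by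
      rcases hz with hz | hz | hz | hz
      · rcases hx with hx | hx | hx | hx
        · omega
        · omega
        · omega
        · have := h.nonneg hx; omega
      · rcases hx with hx | hx | hx | hx
        · omega
        · omega
        · omega
        · have := h.nonneg hx; omega
      · rcases hx with hx | hx | hx | hx
        · omega
        · omega
        · omega
        · have := h.nonneg hx; omega
      · exact hz
    have hz2 := h.nonneg hz'
    refine .inr (.inr (.inr ?_))
    rcases hx with hx | hx | hx | hx
    · omega
    · omega
    · obtain ⟨rfl, rfl⟩ := hx
      exact h.convex.row h0 hz' (by omega) (by omega)
    · exact h.convex.row hx hz' (by omega) (by omega)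
  · simp only [mem_extendBoth]
    intro x y z j hx hz h1 h2
    have hz' : (j - 1, z - 1) ∈ P := by
      rcases hz with hz | hz | hz | hz
      · rcases hx with hx | hx | hx | hx
        · omega
        · omega
        · omega
        · have := h.nonneg hx; omega
      · rcases hx with hx | hx | hx | hx
        · omega
        · omega
        · omega
        · have := h.nonneg hx; omega
      · rcases hx with hx | hx | hx | hx
        · omega
        · omega
        · omega
        · have := h.nonneg hx; omega
      · exact hz
    have hz2 := h.nonneg hz'
    refine .inr (.inr (.inr ?_))
    rcases hx with hx | hx | hx | hx
    · omega
    · obtain ⟨rfl, rfl⟩ := hx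
      exact h.convex.col h0 hz' (by omega) (by omega)
    · omega
    · exact h.convex.col hx hz' (by omega) (by omega)
  · exact mem_extendBoth.2 (.inl ⟨rfl, rfl⟩)
  · rintro ⟨x, y⟩ hxy
    refine ⟨?_, ?_⟩ <;> simp only [Prod.fst_zero, Prod.snd_zero] <;>
    rcases mem_extendBoth.1 hxy with hx | hx | hx | hx <;> first | omega | (have := h.nonneg hx; omega)
  · exact mem_extendBoth.2 (.inr (.inr (.inr (by simpa using h.top_mem))))
  · rintro ⟨x, y⟩ hxy
    have := h.top_nonneg
    refine ⟨?_, ?_⟩ <;> simp only <;>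
    rcases mem_extendBoth.1 hxy with hx | hx | hx | hx <;> first | omega | (have := h.le hx; omega)

theorem area_extendLeft (h : IsNormalized P (p, q)) :
    area (Polyomino.extendLeft P) = area P + 1 := by
  rw [area, Polyomino.extendLeft, Finset.card_insert_of_notMem, Finset.card_vadd_finset, area]
  rw [mem_vadd_iff]
  intro hc
  have := h.nonneg hc
  omega

theorem area_extendDown (h : IsNormalized P (p, q)) :
    area (Polyomino.extendDown P) = area P + 1 := by
  rw [area, Polyomino.extendDown, Finset.card_insert_of_notMem, Finset.card_vadd_finset, area]
  rw [mem_vadd_iff]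
  intro hc
  have := h.nonneg hc
  omega

end IsNormalized

theorem isNormalized_singleton : IsNormalized {((0 : ℤ), (0 : ℤ))} (0, 0) := by
  refine ⟨?_, isHVConvex_iff.2 ⟨?_, ?_⟩, ?_, ?_⟩
  · rw [IsPolyomino, Finset.coe_singleton]
    exact ⟨fun a b => by rw [Subsingleton.elim a b]⟩
  · simp only [Finset.mem_singleton, Prod.mk.injEq]; omega
  · simp only [Finset.mem_singleton, Prod.mk.injEq]; omega
  · rw [Finset.coe_singleton]; exact isLeast_singleton
  · rw [Finset.coe_singleton]; exact isGreatest_singleton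

theorem injOn_extendLeft : Set.InjOn extendLeft {P | ∃ b, IsNormalized P b} := by
  rintro P ⟨⟨p, q⟩, hP⟩ P' ⟨⟨p', q'⟩, hP'⟩ h
  ext ⟨x, y⟩
  have h1 := Finset.ext_iff.1 h (x + 1, y)
  simp only [mem_extendLeft, add_sub_cancel_right] at h1
  constructor <;> intro hx
  · have := hP.nonneg hx
    exact (h1.1 (.inr hx)).resolve_left (by omega)
  · have := hP'.nonneg hx
    exact (h1.2 (.inr hx)).resolve_left (by omega)

theorem injOn_extendDown : Set.InjOn extendDown {P | ∃ b, IsNormalized P b} := by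
  rintro P ⟨⟨p, q⟩, hP⟩ P' ⟨⟨p', q'⟩, hP'⟩ h
  ext ⟨x, y⟩
  have h1 := Finset.ext_iff.1 h (x, y + 1)
  simp only [mem_extendDown, add_sub_cancel_right] at h1
  constructor <;> intro hx
  · have := hP.nonneg hx
    exact (h1.1 (.inr hx)).resolve_left (by omega)
  · have := hP'.nonneg hx
    exact (h1.2 (.inr hx)).resolve_left (by omega)

theorem injOn_extendBoth : Set.InjOn extendBoth {P | ∃ b, IsNormalized P b} := by
  rintro P ⟨⟨p, q⟩, hP⟩ P' ⟨⟨p', q'⟩, hP'⟩ h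
  ext ⟨x, y⟩
  have h1 := Finset.ext_iff.1 h (x + 1, y + 1)
  simp only [mem_extendBoth, add_sub_cancel_right] at h1
  constructor <;> intro hx
  · have := hP.nonneg hx
    rcases h1.1 (.inr (.inr (.inr hx))) with h2 | h2 | h2 | h2
    · omega
    · omega
    · omega
    · exact h2
  · have := hP'.nonneg hx
    rcases h1.2 (.inr (.inr (.inr hx))) with h2 | h2 | h2 | h2
    · omega
    · omega
    · omega
    · exact h2

theorem disjoint_image_extendLeft_extendDown {S T : Set (Finset Cell)}
    (hS : ∀ P ∈ S, ∃ b, IsNormalized P b) (hT : ∀ P ∈ T, ∃ b, IsNormalized P b) :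
    Disjoint (extendLeft '' S) (extendDown '' T) := by
  rw [Set.disjoint_left]
  rintro - ⟨P, hP, rfl⟩ ⟨P', hP', h⟩
  obtain ⟨⟨p, q⟩, hP⟩ := hS P hP
  obtain ⟨⟨p', q'⟩, hP'⟩ := hT P' hP'
  have h1 := (Finset.ext_iff.1 h (1, 0)).2 (mem_extendLeft.2 (.inr (by simpa using hP.zero_mem)))
  rcases mem_extendDown.1 h1 with h2 | h2
  · omega
  · have := hP'.nonneg h2; omega

/-- Both `(1, 0)` and `(0, 1)` lie in an `extendBoth`, whereas `extendLeft` misses `(0, 1)` and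
`extendDown` misses `(1, 0)`. -/
theorem disjoint_image_extend_extendBoth {S T U : Set (Finset Cell)}
    (hS : ∀ P ∈ S, ∃ b, IsNormalized P b) (hT : ∀ P ∈ T, ∃ b, IsNormalized P b) :
    Disjoint (extendLeft '' S ∪ extendDown '' T) (extendBoth '' U) := by
  rw [Set.disjoint_left]
  rintro - (⟨P, hP, rfl⟩ | ⟨P, hP, rfl⟩) ⟨P', hP', h⟩
  · obtain ⟨⟨p, q⟩, hP⟩ := hS P hP
    have h1 := (Finset.ext_iff.1 h (0, 1)).1 (mem_extendBoth.2 (by simp))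
    rcases mem_extendLeft.1 h1 with h2 | h2
    · omega
    · have := hP.nonneg h2; omega
  · obtain ⟨⟨p, q⟩, hP⟩ := hT P hP
    have h1 := (Finset.ext_iff.1 h (1, 0)).1 (mem_extendBoth.2 (by simp))
    rcases mem_extendDown.1 h1 with h2 | h2
    · omega
    · have := hP.nonneg h2; omega

/-! ### Exponential lower bounds for the total counts. -/

theorem countArea_eq (n : ℕ) :
    countArea n = {P | (∃ b, IsNormalized P b) ∧ area P = n}.ncard :=
  numClasses_eq_ncard (Q := fun P => area P = n) fun v P h => by rw [area_vadd, h]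

theorem countHalfPerimeter_eq (n : ℕ) :
    countHalfPerimeter n = {P | (∃ b, IsNormalized P b) ∧ halfPerimeter P = n}.ncard :=
  numClasses_eq_ncard (Q := fun P => halfPerimeter P = n) fun v P h => by
    rw [halfPerimeter_vadd, h]

theorem two_mul_countArea_le (n : ℕ) : 2 * countArea n ≤ countArea (n + 1) := by
  rw [countArea_eq, countArea_eq]
  set S := {P | (∃ b, IsNormalized P b) ∧ area P = n} with hS
  have hfin : S.Finite := finite_isNormalized_area n
  have hSn : ∀ P ∈ S, ∃ b, IsNormalized P b := fun P hP => hP.1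
  rw [two_mul]
  nth_rw 1 [← (injOn_extendLeft.mono hSn).ncard_image]
  rw [← (injOn_extendDown.mono hSn).ncard_image,
    ← Set.ncard_union_eq (disjoint_image_extendLeft_extendDown hSn hSn) (hfin.image _)
      (hfin.image _)]
  refine Set.ncard_le_ncard ?_ (finite_isNormalized_area _)
  rintro - (⟨P, ⟨⟨⟨p, q⟩, hP⟩, rfl⟩, rfl⟩ | ⟨P, ⟨⟨⟨p, q⟩, hP⟩, rfl⟩, rfl⟩)
  · exact ⟨⟨_, hP.extendLeft⟩, hP.area_extendLeft⟩
  · exact ⟨⟨_, hP.extendDown⟩, hP.area_extendDown⟩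

theorem countHalfPerimeter_recurrence_le (n : ℕ) :
    2 * countHalfPerimeter (n + 1) + countHalfPerimeter n ≤ countHalfPerimeter (n + 2) := by
  rw [countHalfPerimeter_eq, countHalfPerimeter_eq, countHalfPerimeter_eq]
  set S := {P | (∃ b, IsNormalized P b) ∧ halfPerimeter P = n + 1} with hS
  set T := {P | (∃ b, IsNormalized P b) ∧ halfPerimeter P = n} with hT
  have hfin : S.Finite := finite_isNormalized_halfPerimeter _
  have hfinT : T.Finite := finite_isNormalized_halfPerimeter _
  have hSn : ∀ P ∈ S, ∃ b, IsNormalized P b := fun P hP => hP.1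
  have hTn : ∀ P ∈ T, ∃ b, IsNormalized P b := fun P hP => hP.1
  rw [two_mul]
  nth_rw 1 [← (injOn_extendLeft.mono hSn).ncard_image]
  rw [← (injOn_extendDown.mono hSn).ncard_image,
    ← (injOn_extendBoth.mono hTn).ncard_image,
    ← Set.ncard_union_eq (disjoint_image_extendLeft_extendDown hSn hSn) (hfin.image _)
      (hfin.image _),
    ← Set.ncard_union_eq (disjoint_image_extend_extendBoth hSn hSn)
      ((hfin.image _).union (hfin.image _)) (hfinT.image _)]
  refine Set.ncard_le_ncard ?_ (finite_isNormalized_halfPerimeter _)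
  rintro - ((⟨P, ⟨⟨⟨p, q⟩, hP⟩, hn⟩, rfl⟩ | ⟨P, ⟨⟨⟨p, q⟩, hP⟩, hn⟩, rfl⟩) |
    ⟨P, ⟨⟨⟨p, q⟩, hP⟩, hn⟩, rfl⟩)
  · have h1 := hP.halfPerimeter_eq
    have h2 := hP.extendLeft.halfPerimeter_eq
    exact ⟨⟨_, hP.extendLeft⟩, by omega⟩
  · have h1 := hP.halfPerimeter_eq
    have h2 := hP.extendDown.halfPerimeter_eq
    exact ⟨⟨_, hP.extendDown⟩, by omega⟩
  · have h1 := hP.halfPerimeter_eq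
    have h2 := hP.extendBoth.halfPerimeter_eq
    exact ⟨⟨_, hP.extendBoth⟩, by omega⟩

theorem two_pow_le_countArea (n : ℕ) : 2 ^ n ≤ countArea (n + 1) := by
  induction n with
  | zero =>
    rw [countArea_eq, pow_zero, Nat.one_le_iff_ne_zero, ← Nat.pos_iff_ne_zero,
      Set.ncard_pos (finite_isNormalized_area _)]
    exact ⟨_, ⟨_, isNormalized_singleton⟩, by simp [area]⟩
  | succ n ih =>
    have := two_mul_countArea_le (n + 1)
    rw [pow_succ]; omega

/-- The base `12/5` satisfies `(12/5) ^ 2 ≤ 2 * (12/5) + 1`, so the recurrence propagates the bound,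
and it exceeds `2`. The factor `2` on the right makes room for the case `n = 1`, where only
`countHalfPerimeter 3 ≥ 2` is available. -/
theorem pow_le_countHalfPerimeter (n : ℕ) :
    (12 / 5 : ℝ) ^ n ≤ 2 * countHalfPerimeter (n + 2) := by
  have h0 : 1 ≤ countHalfPerimeter 2 := by
    rw [countHalfPerimeter_eq, Nat.one_le_iff_ne_zero, ← Nat.pos_iff_ne_zero,
      Set.ncard_pos (finite_isNormalized_halfPerimeter _)]
    exact ⟨_, ⟨_, isNormalized_singleton⟩, by simp [halfPerimeter, width, height]⟩
  have h1 : 2 * countHalfPerimeter 2 + countHalfPerimeter 1 ≤ countHalfPerimeter 3 :=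
    countHalfPerimeter_recurrence_le 1
  induction n using Nat.twoStepInduction with
  | zero =>
    have : (1 : ℝ) ≤ countHalfPerimeter 2 := by exact_mod_cast h0
    norm_num; linarith
  | one =>
    have : (2 : ℝ) ≤ countHalfPerimeter 3 := by
      have : 2 ≤ countHalfPerimeter 3 := by omega
      exact_mod_cast this
    norm_num; linarith
  | more n ih1 ih2 =>
    have h2 : (2 : ℝ) * countHalfPerimeter (n + 1 + 2) + countHalfPerimeter (n + 2) ≤
        countHalfPerimeter (n + 2 + 2) := by
      exact_mod_cast countHalfPerimeter_recurrence_le (n + 2)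
    have h3 : (0 : ℝ) < (12 / 5) ^ n := by positivity
    rw [pow_succ] at ih2
    rw [pow_succ, pow_succ]
    linarith

/-! ### Comparison of the symmetric and total counts. -/

theorem abs_asymCountArea_sub_le {n : ℕ} (hn : 1 ≤ n) :
    |(asymCountArea n : ℝ) - countArea n| ≤ 4 * (n ^ 3 * (7 / 4 : ℝ) ^ n) := by
  have hQ : ∀ (v : Cell) P, area P = n → area (v +ᵥ P) = n := fun v P h => by rw [area_vadd, h]
  have h1 : asymCountArea n ≤ countArea n :=
    numClasses_asymmetric_le hQ (finite_isNormalized_area n)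
  have h2 := numClasses_le_asymmetric_add hQ (finite_isNormalized_area n)
  have h3 := (ncard_reversal_area_le (.inl rfl) n).2
  have h4 := (ncard_reversal_area_le (.inr rfl) n).2
  have h5 : {P | (∃ b, IsNormalized P b) ∧ IsSymmetricUnder diagReflection P ∧
      area P = n}.ncard ≤ (2 * n / 3 + 1) * 2 ^ (2 * n / 3) := by
    refine (Set.ncard_le_ncard ?_ (ncard_diagReflection_le (2 * n / 3)).1).trans
      (ncard_diagReflection_le (2 * n / 3)).2
    rintro P ⟨⟨⟨p, q⟩, hP⟩, hs, hn⟩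
    obtain ⟨M, lo, hi, hM, hp⟩ := hP.exists_profile'
    have h1 := hp.three_mul_le_of_diag (hP.diagReflection_mem_iff hs)
    have h2 := hP.halfPerimeter_eq
    exact ⟨⟨_, hP⟩, hs, by omega⟩
  have h6 : countArea n ≤ asymCountArea n + (n * n * n * 3 ^ (n / 2) + n * n * n * 3 ^ (n / 2) +
      (2 * n / 3 + 1) * 2 ^ (2 * n / 3)) :=
    h2.trans (Nat.add_le_add_left (Nat.add_le_add (Nat.add_le_add h3 h4) h5) _)
  -- The constant `7/4` lies below `2` and satisfies `3 ≤ (7/4) ^ 2` and `2 ^ 2 ≤ (7/4) ^ 3`, which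
  -- absorbs both kinds of symmetry.
  have h7 : (3 : ℝ) ^ (n / 2) ≤ (7 / 4) ^ n := by
    calc (3 : ℝ) ^ (n / 2) ≤ ((7 / 4) ^ 2) ^ (n / 2) := by gcongr; norm_num
      _ = (7 / 4) ^ (2 * (n / 2)) := by rw [pow_mul]
      _ ≤ (7 / 4) ^ n := pow_le_pow_right₀ (by norm_num) (by omega)
  have h8 : (2 : ℝ) ^ (2 * n / 3) ≤ (7 / 4) ^ n := by
    refine le_of_pow_le_pow_left₀ (n := 3) (by norm_num) (by positivity) ?_
    calc ((2 : ℝ) ^ (2 * n / 3)) ^ 3 = 2 ^ (2 * n / 3 * 3) := by rw [pow_mul]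
      _ ≤ 2 ^ (2 * n) := pow_le_pow_right₀ (by norm_num) (by omega)
      _ = (2 ^ 2) ^ n := by rw [pow_mul]
      _ ≤ ((7 / 4) ^ 3) ^ n := by gcongr; norm_num
      _ = ((7 / 4) ^ n) ^ 3 := by rw [← pow_mul, ← pow_mul, mul_comm]
  have h9 : ((2 * n / 3 + 1 : ℕ) : ℝ) ≤ 2 * n ^ 3 := by
    have : 2 * n / 3 + 1 ≤ 2 * n ^ 3 := by
      have : n ≤ n ^ 3 := Nat.le_self_pow (by norm_num) n
      omega
    exact_mod_cast this
  have h6' : (countArea n : ℝ) ≤ asymCountArea n + ((n : ℝ) * n * n * 3 ^ (n / 2) +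
      (n : ℝ) * n * n * 3 ^ (n / 2) + ((2 * n / 3 + 1 : ℕ) : ℝ) * 2 ^ (2 * n / 3)) := by
    exact_mod_cast h6
  have h1' : (asymCountArea n : ℝ) ≤ countArea n := by exact_mod_cast h1
  have h10 : (n : ℝ) * n * n * 3 ^ (n / 2) ≤ n ^ 3 * (7 / 4 : ℝ) ^ n := by
    rw [show (n : ℝ) * n * n = n ^ 3 by ring]; gcongr
  have h11 : ((2 * n / 3 + 1 : ℕ) : ℝ) * 2 ^ (2 * n / 3) ≤ 2 * n ^ 3 * (7 / 4 : ℝ) ^ n := by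
    gcongr
  rw [abs_sub_comm, abs_of_nonneg (by linarith)]
  linarith

theorem abs_asymCountHalfPerimeter_sub_le {n : ℕ} (hn : 1 ≤ n) :
    |(asymCountHalfPerimeter n : ℝ) - countHalfPerimeter n| ≤ 4 * (n ^ 1 * (2 : ℝ) ^ n) := by
  have hQ : ∀ (v : Cell) P, halfPerimeter P = n → halfPerimeter (v +ᵥ P) = n := fun v P h => by
    rw [halfPerimeter_vadd, h]
  have h1 : asymCountHalfPerimeter n ≤ countHalfPerimeter n :=
    numClasses_asymmetric_le hQ (finite_isNormalized_halfPerimeter n)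
  have h2 := numClasses_le_asymmetric_add hQ (finite_isNormalized_halfPerimeter n)
  have h3 := (ncard_reversal_halfPerimeter_le (.inl rfl) n).2
  have h4 := (ncard_reversal_halfPerimeter_le (.inr rfl) n).2
  have h5 : {P | (∃ b, IsNormalized P b) ∧ IsSymmetricUnder diagReflection P ∧
      halfPerimeter P = n}.ncard ≤ (n + 1) * 2 ^ n := by
    refine (Set.ncard_le_ncard ?_ (ncard_diagReflection_le n).1).trans (ncard_diagReflection_le n).2
    rintro P ⟨hP, hs, hn⟩
    exact ⟨hP, hs, by omega⟩
  have h6 : countHalfPerimeter n ≤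
      asymCountHalfPerimeter n + (n * 2 ^ n + n * 2 ^ n + (n + 1) * 2 ^ n) :=
    h2.trans (Nat.add_le_add_left (Nat.add_le_add (Nat.add_le_add h3 h4) h5) _)
  have h6' : (countHalfPerimeter n : ℝ) ≤ asymCountHalfPerimeter n +
      ((n : ℝ) * 2 ^ n + (n : ℝ) * 2 ^ n + ((n : ℝ) + 1) * 2 ^ n) := by
    exact_mod_cast h6
  have h1' : (asymCountHalfPerimeter n : ℝ) ≤ countHalfPerimeter n := by exact_mod_cast h1
  have h7 : ((n : ℝ) + 1) * 2 ^ n ≤ (n + n) * 2 ^ n := by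
    have : (1 : ℝ) ≤ n := by exact_mod_cast hn
    gcongr
  rw [abs_sub_comm, abs_of_nonneg (by linarith)]
  linarith

/-- Two sequences are equivalent if their difference is exponentially smaller than the second. -/
theorem isEquivalent_of_exponential_bounds {u v : ℕ → ℝ} {C C' r s : ℝ} {k : ℕ} (hr : 0 ≤ r)
    (hrs : r < s) (h : ∀ n, 1 ≤ n → |u n - v n| ≤ C * (n ^ k * r ^ n))
    (h' : ∀ n, 2 ≤ n → s ^ n ≤ C' * |v n|) : u ~[Filter.atTop] v := by
  have h1 : (u - v) =O[Filter.atTop] fun n : ℕ => (n : ℝ) ^ k * r ^ n := by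
    refine Asymptotics.IsBigO.of_bound C ?_
    filter_upwards [Filter.eventually_ge_atTop 1] with n hn
    rw [Real.norm_eq_abs, Real.norm_of_nonneg (by positivity)]
    exact h n hn
  have h2 : (fun n : ℕ => (n : ℝ) ^ k * r ^ n) =o[Filter.atTop] fun n : ℕ => s ^ n :=
    isLittleO_pow_const_mul_const_pow_const_pow_of_norm_lt k (by rwa [Real.norm_of_nonneg hr])
  have h3 : (fun n : ℕ => s ^ n) =O[Filter.atTop] v := by
    refine Asymptotics.IsBigO.of_bound C' ?_
    filter_upwards [Filter.eventually_ge_atTop 2] with n hn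
    rw [Real.norm_eq_abs, abs_of_nonneg (pow_nonneg (hr.trans hrs.le) n)]
    exact h' n hn
  exact (h1.trans_isLittleO h2).trans_isBigO h3

end

end Polyomino

theorem mainTheorem3 :
    ((fun n : ℕ => (Polyomino.asymCountArea n : ℝ)) ~[Filter.atTop]
        (fun n : ℕ => (Polyomino.countArea n : ℝ))) ∧
      ((fun n : ℕ => (Polyomino.asymCountHalfPerimeter n : ℝ)) ~[Filter.atTop]
        (fun n : ℕ => (Polyomino.countHalfPerimeter n : ℝ))) := by
  constructor
  · refine Polyomino.isEquivalent_of_exponential_bounds (r := 7 / 4) (s := 2) (C' := 2)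
      (by norm_num) (by norm_num) (fun n hn => Polyomino.abs_asymCountArea_sub_le hn) ?_
    intro n hn
    obtain ⟨m, rfl⟩ := Nat.exists_eq_add_of_le' (show 1 ≤ n by omega)
    have : (2 : ℝ) ^ m ≤ Polyomino.countArea (m + 1) := by
      exact_mod_cast Polyomino.two_pow_le_countArea m
    rw [Nat.abs_cast, pow_succ]
    linarith
  -- In `C'` the factor `(12/5) ^ 2` pays for the index shift by two, and `2` is the factor of
  -- `pow_le_countHalfPerimeter`.
  · refine Polyomino.isEquivalent_of_exponential_bounds (r := 2) (s := 12 / 5)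
      (C' := 2 * (12 / 5) ^ 2) (by norm_num) (by norm_num)
      (fun n hn => Polyomino.abs_asymCountHalfPerimeter_sub_le hn) ?_
    intro n hn
    obtain ⟨m, rfl⟩ := Nat.exists_eq_add_of_le' hn
    have := Polyomino.pow_le_countHalfPerimeter m
    rw [Nat.abs_cast, pow_add]
    linarith
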